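/- Let $n\ge 0$ and let $\overrightarrow{G}=([n],E)$ be a directed graph without loops and with at most one edge $(u,v)$ for every ordered pair $u\ne v$ (both $(u,v)$ and $(v,u)$ may be edges). Let $G$ be its underlying simple undirected graph: $u\ne v$ are adjacent iff $(u,v)\in E$ or $(v,u)\in E$. The chromatic quasisymmetric function of $\overrightarrow{G}$ is $$X_{\overrightarrow{G}}(\mathbf{x},t)=\sum_{\kappa}t^{\mathrm{asc}(\kappa)}\prod_{v\in[n]}x_{\kappa(v)},$$ where $\kappa:[n]\to\{1,2,\dots\}$ runs over the proper colorings of $G$ and $\mathrm{asc}(\kappa)=|\{(u,v)\in E:\kappa(u)<\kappa(v)\}|$. Let $\Lambda_{\mathbb{Q}[t]}$ be the ring of symmetric functions in $x_1,x_2,\dots$ with coefficients in $\mathbb{Q}[t]$, and let $\omega$ be the involution on it, i.e. the $\mathbb{Q}[t]$-algebra endomorphism that sends the complete homogeneous symmetric function $h_k$ to the elementary symmetric function $e_k$ for every $k$. For a permutation $\sigma=\sigma_1\sigma_2\cdots\sigma_n\in\mathfrak{S}_n$, let $\mathrm{inv}_{\overrightarrow{G}}(\sigma)$ be the number of edges $(u,v)\in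 E$ such that $v$ precedes $u$ in $\sigma$. The rank of a letter $x$ in $\sigma$ is the length of the longest subword $\sigma_{i_1}\cdots\sigma_{i_k}$, $i_1<\cdots<i_k$, with $\sigma_{i_k}=x$ and $\sigma_{i_j}$ adjacent to $\sigma_{i_{j+1}}$ in $G$ for $1\le j<k$. The permutation $\sigma$ has a $G$-descent at $i$, $1\le i<n$, if $\mathrm{rank}(\sigma_i)>\mathrm{rank}(\sigma_{i+1})$, or if these ranks are equal and $\sigma_i>\sigma_{i+1}$. A letter $w_j$, $j>1$, of a word $w=w_1\cdots w_k$ is $G$-isolated if no $w_i$ with $i<j$ is adjacent to $w_j$ in $G$. For a partition $\lambda=(\lambda_1\ge\dots\ge\lambda_l)$ of $n$, let $N_\lambda(G)$ be the set of all $\sigma\in\mathfrak{S}_n$ such that, when $\sigma$ is cut into contiguous segments $\alpha_1,\dots,\alpha_l$ of lengths $\lambda_1,\dots,\lambda_l$, no $\alpha_i$ has a $G$-isolated letter and no $\alpha_i$ contains a $G$-descent of $\sigma$ (that is, $\sigma$ has no $G$-descent at a position $j$ for which $j$ and $j+1$ lie in the same segment). Let $p_\lambda=\prod_i p_{\lambda_i}$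 with $p_k=\sum_i x_i^k$, and $z_\lambda=\prod_i m_i(\lambda)!\,i^{m_i(\lambda)}$, where $m_i(\lambda)$ is the multiplicity of $i$ in $\lambda$. **Theorem.** If $X_{\overrightarrow{G}}(\mathbf{x},t)$ is symmetric, i.e. $X_{\overrightarrow{G}}(\mathbf{x},t)\in\Lambda_{\mathbb{Q}[t]}$, then $$\omega X_{\overrightarrow{G}}(\mathbf{x},t)=\sum_{\lambda\vdash n}z_\lambda^{-1}\,p_\lambda(\mathbf{x})\sum_{\sigma\in N_\lambda(G)}t^{\mathrm{inv}_{\overrightarrow{G}}(\sigma)}.$$ In particular $\omega X_{\overrightarrow{G}}(\mathbf{x},t)$ is $p$-positive: its expansion in the $p_\lambda$, $\lambda\vdash n$, has coefficients in $\mathbb{Q}[t]$ all of whose coefficients are nonnegative. -/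

import Mathlib

noncomputable section

namespace ChromQSym

open MvPowerSeries Finsupp

variable (R : Type*) [CommRing R]

/-- The ring `Λ_R` of symmetric functions over `R`: the formal power series of bounded degree in
countably many variables that are fixed by every permutation of the variables. The variable
`x_i`, `i = 1, 2, …`, is the one with index `i - 1`. -/
def SymFunc : Subalgebra R (MvPowerSeries ℕ R) where
  carrier := {f | (∃ d : ℕ, ∀ m : ℕ →₀ ℕ, d < m.degree → coeff m f = 0) ∧
    ∀ π : Equiv.Perm ℕ, rename π f = f}
  mul_mem' := by
    classical
    rintro f g ⟨⟨d, hd⟩, hf⟩ ⟨⟨e, he⟩, hg⟩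
    refine ⟨⟨d + e, fun m hm => ?_⟩, fun π => by rw [map_mul, hf, hg]⟩
    rw [coeff_mul]
    refine Finset.sum_eq_zero fun p hp => ?_
    rw [Finset.HasAntidiagonal.mem_antidiagonal] at hp
    have hdeg : p.1.degree + p.2.degree = m.degree := by rw [← hp, map_add]
    by_cases h : d < p.1.degree
    · rw [hd _ h, zero_mul]
    · rw [he _ (by omega), mul_zero]
  add_mem' := by
    rintro f g ⟨⟨d, hd⟩, hf⟩ ⟨⟨e, he⟩, hg⟩
    refine ⟨⟨max d e, fun m hm => ?_⟩, fun π => by rw [map_add, hf, hg]⟩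
    rw [map_add, hd m (by omega), he m (by omega), add_zero]
  algebraMap_mem' r := by
    classical
    refine ⟨⟨0, fun m hm => ?_⟩, fun π => AlgHom.commutes _ r⟩
    rw [MvPowerSeries.algebraMap_apply, coeff_C, if_neg]
    rintro rfl
    simp at hm

variable {R}

theorem coeff_mapDomain_perm_rename (π : Equiv.Perm ℕ) (f : MvPowerSeries ℕ R) (m : ℕ →₀ ℕ) :
    coeff (mapDomain π m) (rename π f) = coeff m f := by
  have := coeff_embDomain_rename π.toEmbedding f m
  rwa [embDomain_eq_mapDomain] at this

theorem rename_perm_eq_of_coeff {f : MvPowerSeries ℕ R} (π : Equiv.Perm ℕ)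
    (h : ∀ m : ℕ →₀ ℕ, coeff (mapDomain π m) f = coeff m f) : rename π f = f := by
  ext m
  obtain ⟨m', rfl⟩ : ∃ m', mapDomain π m' = m :=
    ⟨mapDomain π.symm m, by rw [← mapDomain_comp]; simp⟩
  rw [coeff_mapDomain_perm_rename, h]

variable (R) in
open Classical in
/-- The elementary symmetric function `e_k`: the sum of all square-free monomials of degree `k`. -/
def esymm (k : ℕ) : SymFunc R :=
  ⟨fun m => if m.degree = k ∧ ∀ i, m i ≤ 1 then 1 else 0, by
    refine ⟨⟨k, fun m hm => if_neg fun h => hm.ne' h.1⟩,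
      fun π => rename_perm_eq_of_coeff π fun m => ?_⟩
    refine if_congr ?_ rfl rfl
    rw [Finsupp.degree_mapDomain]
    refine and_congr_right fun _ => ⟨fun h i => ?_, fun h i => ?_⟩
    · simpa [mapDomain_equiv_apply] using h (π i)
    · simpa [mapDomain_equiv_apply] using h (π.symm i)⟩

variable (R) in
open Classical in
/-- The complete homogeneous symmetric function `h_k`: the sum of all monomials of degree `k`. -/
def hsymm (k : ℕ) : SymFunc R :=
  ⟨fun m => if m.degree = k then 1 else 0, by
    refine ⟨⟨k, fun m hm => if_neg hm.ne'⟩,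
      fun π => rename_perm_eq_of_coeff π fun m => ?_⟩
    refine if_congr ?_ rfl rfl
    rw [Finsupp.degree_mapDomain]⟩

variable (R) in
open Classical in
/-- The power sum symmetric function `p_k`, `k ≥ 1`: the sum of all `x_i ^ k`.
(For `k = 0`, which never occurs, this gives `1`.) -/
def psum (k : ℕ) : SymFunc R :=
  ⟨fun m => if ∃ i, m = single i k then 1 else 0, by
    refine ⟨⟨k, fun m hm => if_neg ?_⟩,
      fun π => rename_perm_eq_of_coeff π fun m => if_congr ?_ rfl rfl⟩
    · rintro ⟨i, rfl⟩
      simp at hm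
    · refine ⟨fun ⟨i, hi⟩ => ⟨π.symm i, mapDomain_injective π.injective ?_⟩, fun ⟨i, hi⟩ => ⟨π i, ?_⟩⟩
      · rw [hi, mapDomain_single, π.apply_symm_apply]
      · rw [hi, mapDomain_single]⟩

open Classical in
theorem coeff_esymm (k : ℕ) (m : ℕ →₀ ℕ) :
    coeff m (esymm R k : MvPowerSeries ℕ R) = if m.degree = k ∧ ∀ i, m i ≤ 1 then 1 else 0 := rfl

open Classical in
theorem coeff_hsymm (k : ℕ) (m : ℕ →₀ ℕ) :
    coeff m (hsymm R k : MvPowerSeries ℕ R) = if m.degree = k then 1 else 0 := rfl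

/-- Setting all but the first `N` variables to zero. -/
def restr (N : ℕ) : SymFunc R →ₐ[R] MvPowerSeries (Fin N) R :=
  (killCompl Fin.valEmbedding).comp (SymFunc R).val

theorem restr_esymm (N k : ℕ) : restr N (esymm R k) = (MvPolynomial.esymm (Fin N) R k : MvPowerSeries (Fin N) R) := by
  classical
  ext m
  rw [MvPolynomial.coeff_coe, MvPolynomial.esymm_eq_sum_monomial, MvPolynomial.coeff_sum]
  simp only [restr, AlgHom.comp_apply, Subalgebra.val_apply, coeff_killCompl, coeff_esymm, MvPolynomial.coeff_monomial]
  rw [embDomain_eq_mapDomain, Finsupp.degree_mapDomain]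
  have key : ∀ t : Finset (Fin N), (∑ i ∈ t, single i 1) = m ↔ (t = m.support ∧ ∀ i, m i ≤ 1) := by
    intro t
    have h1 : ∀ i, (∑ j ∈ t, single j 1 : Fin N →₀ ℕ) i = if i ∈ t then 1 else 0 := by
      intro i; simp [Finsupp.finsetSum_apply, single_apply]
    constructor
    · rintro rfl
      refine ⟨by ext i; simp [h1], fun i => by rw [h1]; split_ifs <;> simp⟩
    · rintro ⟨rfl, h⟩
      ext i
      rw [h1]
      have := h i
      by_cases h0 : m i = 0
      · simp [h0]
      · rw [if_pos (by simpa using h0)]; omega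
  simp only [key]
  have hm : (∀ i, (mapDomain (Fin.valEmbedding : Fin N ↪ ℕ) m) i ≤ 1) ↔ ∀ i, m i ≤ 1 := by
    constructor
    · intro h i
      have := h (Fin.valEmbedding i)
      rwa [mapDomain_apply Fin.valEmbedding.injective] at this
    · intro h i
      by_cases hi : i ∈ Set.range (Fin.valEmbedding : Fin N ↪ ℕ)
      · obtain ⟨j, rfl⟩ := hi
        rw [mapDomain_apply Fin.valEmbedding.injective]; exact h j
      · rw [mapDomain_of_notMem_range _ _ hi]; simp
  rw [hm]
  by_cases h : ∀ i, m i ≤ 1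
  · have hd : m.degree = m.support.card := by
      rw [Finsupp.degree_apply, Finset.card_eq_sum_ones]
      refine Finset.sum_congr rfl fun i hi => ?_
      have := h i
      have := mem_support_iff.1 hi
      omega
    simp [h, hd, Finset.sum_ite_eq', Finset.mem_powersetCard]
  · simp [h]

variable (R) in
/-- Evaluation of polynomials at `e_1, e_2, …`. -/
def ofEsymm : MvPolynomial ℕ R →ₐ[R] SymFunc R := MvPolynomial.aeval fun i => esymm R (i + 1)

theorem restr_ofEsymm_rename (N : ℕ) (Q : MvPolynomial (Fin N) R) :
    restr N (ofEsymm R (MvPolynomial.rename Fin.val Q)) =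
      ((MvPolynomial.esymmAlgHom (Fin N) R N Q : MvPolynomial (Fin N) R) : MvPowerSeries (Fin N) R) := by
  have : ((restr N).comp (ofEsymm R)).comp (MvPolynomial.rename Fin.val) =
    ((MvPolynomial.coeToMvPowerSeries.algHom R).comp (MvPolynomial.symmetricSubalgebra (Fin N) R).val).comp (MvPolynomial.esymmAlgHom (Fin N) R N) := by
    refine MvPolynomial.algHom_ext fun i => ?_
    simp [ofEsymm, restr_esymm, MvPolynomial.esymmAlgHom]
  simpa using DFunLike.congr_fun this Q

theorem ofEsymm_injective : Function.Injective (ofEsymm R) := by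
  rw [injective_iff_map_eq_zero]
  intro P hP
  obtain ⟨s, q, rfl⟩ := MvPolynomial.exists_finset_rename P
  obtain ⟨N, hN⟩ : ∃ N, ∀ i ∈ s, i < N := ⟨s.sup id + 1, fun i hi => Nat.lt_succ_of_le (Finset.le_sup (f := id) hi)⟩
  have h1 : MvPolynomial.rename (Subtype.val : {x // x ∈ s} → ℕ) q =
      MvPolynomial.rename Fin.val (MvPolynomial.rename (fun i : {x // x ∈ s} => (⟨i, hN i i.2⟩ : Fin N)) q) := by
    rw [MvPolynomial.rename_rename]; rfl
  rw [h1] at hP ⊢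
  have h2 := restr_ofEsymm_rename N (MvPolynomial.rename (fun i : {x // x ∈ s} => (⟨i, hN i i.2⟩ : Fin N)) q)
  rw [hP, map_zero] at h2
  have h3 := MvPolynomial.esymmAlgHom_injective R (σ := Fin N) (n := N) (by simp)
  have h4 : MvPolynomial.esymmAlgHom (Fin N) R N (MvPolynomial.rename (fun i : {x // x ∈ s} => (⟨i, hN i i.2⟩ : Fin N)) q) = 0 := by
    apply Subtype.ext
    apply MvPolynomial.coe_injective
    simpa using h2.symm
  rw [(map_eq_zero_iff _ h3).1 h4, map_zero]

theorem ofEsymm_trunc (d : ℕ) (P : MvPolynomial ℕ R) : ∃ P' : MvPolynomial ℕ R, ∀ m : ℕ →₀ ℕ,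
    coeff m (ofEsymm R P' : MvPowerSeries ℕ R) =
      if m.degree ≤ d then coeff m (ofEsymm R P : MvPowerSeries ℕ R) else 0 := by
  induction P using MvPolynomial.induction_on' with
  | monomial s r =>
    have hom : ∃ w, ∀ m : ℕ →₀ ℕ, m.degree ≠ w →
        coeff m (ofEsymm R (MvPolynomial.monomial s r) : MvPowerSeries ℕ R) = 0 := by
      induction s using Finsupp.induction_linear generalizing r with
      | zero =>
        refine ⟨0, fun m hm => ?_⟩
        classical
        have : ofEsymm R (MvPolynomial.monomial 0 r) = algebraMap R _ r := by
          rw [← MvPolynomial.C_apply, ← MvPolynomial.algebraMap_eq, AlgHom.commutes]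
        rw [this, Subalgebra.coe_algebraMap, MvPowerSeries.algebraMap_apply, coeff_C, if_neg]
        rintro rfl; simp at hm
      | add f g hf hg =>
        obtain ⟨a, ha⟩ := hf r
        obtain ⟨b, hb⟩ := hg 1
        refine ⟨a + b, fun m hm => ?_⟩
        classical
        rw [← mul_one r, ← MvPolynomial.monomial_mul, map_mul, Subalgebra.coe_mul, coeff_mul]
        refine Finset.sum_eq_zero fun p hp => ?_
        rw [Finset.HasAntidiagonal.mem_antidiagonal] at hp
        have hdeg : p.1.degree + p.2.degree = m.degree := by rw [← hp, map_add]
        by_cases h : p.1.degree = a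
        · rw [hb _ (by omega), mul_zero]
        · rw [ha _ h, zero_mul]
      | single i k =>
        induction k generalizing r with
        | zero =>
          refine ⟨0, fun m hm => ?_⟩
          classical
          have : ofEsymm R (MvPolynomial.monomial (single i 0) r) = algebraMap R _ r := by
            rw [single_zero, ← MvPolynomial.C_apply, ← MvPolynomial.algebraMap_eq, AlgHom.commutes]
          rw [this, Subalgebra.coe_algebraMap, MvPowerSeries.algebraMap_apply, coeff_C, if_neg]
          rintro rfl; simp at hm
        | succ k ih =>
          obtain ⟨a, ha⟩ := ih r
          refine ⟨a + (i + 1), fun m hm => ?_⟩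
          classical
          rw [single_add, ← mul_one r, ← MvPolynomial.monomial_mul, map_mul, Subalgebra.coe_mul, coeff_mul]
          refine Finset.sum_eq_zero fun p hp => ?_
          rw [Finset.HasAntidiagonal.mem_antidiagonal] at hp
          have hdeg : p.1.degree + p.2.degree = m.degree := by rw [← hp, map_add]
          by_cases h : p.1.degree = a
          · have : ofEsymm R (MvPolynomial.monomial (single i 1) 1) = esymm R (i + 1) := by
              rw [← MvPolynomial.X, ofEsymm, MvPolynomial.aeval_X]
            rw [this, coeff_esymm, if_neg (by rintro ⟨h', -⟩; omega), mul_zero]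
          · rw [ha _ h, zero_mul]
    obtain ⟨w, hw⟩ := hom
    by_cases h : w ≤ d
    · refine ⟨MvPolynomial.monomial s r, fun m => ?_⟩
      split_ifs with hm
      · rfl
      · exact hw m (by omega)
    · refine ⟨0, fun m => ?_⟩
      rw [map_zero, ZeroMemClass.coe_zero, map_zero]
      split_ifs with hm
      · exact (hw m (by omega)).symm
      · rfl
  | add p q hp hq =>
    obtain ⟨p', hp'⟩ := hp
    obtain ⟨q', hq'⟩ := hq
    refine ⟨p' + q', fun m => ?_⟩
    rw [map_add, map_add, Subalgebra.coe_add, Subalgebra.coe_add, map_add, map_add, hp', hq']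
    split_ifs <;> simp

theorem exists_perm_lt_card (s : Finset ℕ) : ∃ π : Equiv.Perm ℕ, ∀ i ∈ s, π i < s.card := by
  classical
  induction s using Finset.induction_on with
  | empty => exact ⟨1, by simp⟩
  | insert a s ha ih =>
    obtain ⟨π, hπ⟩ := ih
    refine ⟨π.trans (Equiv.swap (π a) s.card), fun i hi => ?_⟩
    rw [Finset.card_insert_of_notMem ha, Equiv.trans_apply]
    rcases Finset.mem_insert.1 hi with rfl | hi
    · rw [Equiv.swap_apply_left]; omega
    · have h1 : π i ≠ π a := fun h => ha (π.injective h ▸ hi)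
      have h2 := hπ i hi
      rw [Equiv.swap_apply_of_ne_of_ne h1 h2.ne]; omega

theorem eq_of_restr_eq {f g : SymFunc R} {d : ℕ}
    (hf : ∀ m : ℕ →₀ ℕ, d < m.degree → coeff m (f : MvPowerSeries ℕ R) = 0)
    (hg : ∀ m : ℕ →₀ ℕ, d < m.degree → coeff m (g : MvPowerSeries ℕ R) = 0)
    (h : ∀ m : Fin d →₀ ℕ, m.degree ≤ d → coeff m (restr d f) = coeff m (restr d g)) : f = g := by
  apply Subtype.ext
  ext m
  by_cases hm : d < m.degree
  · rw [hf m hm, hg m hm]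
  have hc : m.support.card ≤ m.degree := by
    rw [Finsupp.degree_apply, Finset.card_eq_sum_ones]
    refine Finset.sum_le_sum fun i hi => ?_
    have := mem_support_iff.1 hi
    omega
  obtain ⟨π, hπ⟩ := exists_perm_lt_card m.support
  obtain ⟨m', hm'⟩ : mapDomain π m ∈ Set.range (embDomain (Fin.valEmbedding : Fin d ↪ ℕ)) := by
    rw [mem_range_embDomain_iff]
    intro i hi
    obtain ⟨j, hj, rfl⟩ := Finset.mem_image.1 (mapDomain_support hi)
    have := hπ j hj
    exact ⟨⟨π j, by omega⟩, rfl⟩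
  have key : ∀ F : SymFunc R, coeff m (F : MvPowerSeries ℕ R) = coeff m' (restr d F) := by
    intro F
    rw [restr, AlgHom.comp_apply, Subalgebra.val_apply, coeff_killCompl, hm',
      ← coeff_mapDomain_perm_rename π, F.2.2 π]
  rw [key, key]
  apply h
  have h1 : (mapDomain π m).degree = m.degree := Finsupp.degree_mapDomain _ _
  have h2 : (embDomain (Fin.valEmbedding : Fin d ↪ ℕ) m').degree = m'.degree := by
    rw [embDomain_eq_mapDomain, Finsupp.degree_mapDomain]
  rw [← h2, hm', h1]
  omega

theorem ofEsymm_surjective : Function.Surjective (ofEsymm R) := by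
  classical
  intro f
  obtain ⟨d, hd⟩ := f.2.1
  have hfin : {m : Fin d →₀ ℕ | m.degree ≤ d}.Finite := Finsupp.finite_of_degree_le d
  let g : MvPolynomial (Fin d) R :=
    ∑ m ∈ hfin.toFinset, MvPolynomial.monomial m (coeff m (restr d f))
  have hg : ∀ m, MvPolynomial.coeff m g = if m.degree ≤ d then coeff m (restr d f) else 0 := by
    intro m
    simp only [g, MvPolynomial.coeff_sum, MvPolynomial.coeff_monomial]
    rw [Finset.sum_ite_eq']
    simp
  have hsymm : g.IsSymmetric := by
    intro e
    ext m
    obtain ⟨m, rfl⟩ : ∃ m', mapDomain e m' = m :=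
      ⟨mapDomain e.symm m, by rw [← mapDomain_comp]; simp⟩
    rw [MvPolynomial.coeff_rename_mapDomain _ e.injective, hg, hg, Finsupp.degree_mapDomain]
    congr 1
    obtain ⟨π, hπ⟩ : ∃ π : Equiv.Perm ℕ, ∀ i : Fin d, π i = e i :=
      ⟨e.extendDomain Fin.equivSubtype, fun i => by
        have := e.extendDomain_apply_image Fin.equivSubtype i
        simpa using this⟩
    rw [restr, AlgHom.comp_apply, Subalgebra.val_apply, coeff_killCompl, coeff_killCompl,
      ← coeff_mapDomain_perm_rename π, f.2.2 π, embDomain_eq_mapDomain, embDomain_eq_mapDomain,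
      ← mapDomain_comp, ← mapDomain_comp]
    congr 2
    exact congrArg (fun F : Fin d → ℕ => mapDomain F m) (funext fun i => hπ i)
  obtain ⟨Q, hQ⟩ := MvPolynomial.esymmAlgHom_fin_surjective R (le_refl d) ⟨g, hsymm⟩
  obtain ⟨P, hP⟩ := ofEsymm_trunc d (MvPolynomial.rename Fin.val Q)
  refine ⟨P, eq_of_restr_eq (d := d) (fun m hm => ?_) hd fun m hm => ?_⟩
  · rw [hP, if_neg (by omega)]
  · have h1 : coeff m (restr d (ofEsymm R P)) =
        coeff m (restr d (ofEsymm R (MvPolynomial.rename Fin.val Q))) := by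
      rw [restr, AlgHom.comp_apply, AlgHom.comp_apply, Subalgebra.val_apply, Subalgebra.val_apply,
        coeff_killCompl, coeff_killCompl, hP, if_pos]
      rwa [embDomain_eq_mapDomain, Finsupp.degree_mapDomain]
    rw [h1, restr_ofEsymm_rename, hQ, MvPolynomial.coeff_coe, hg, if_pos hm]

theorem esymm_zero : esymm R 0 = 1 := by
  classical
  apply Subtype.ext
  ext m
  rw [coeff_esymm, Subalgebra.coe_one, coeff_one]
  refine if_congr ?_ rfl rfl
  rw [Finsupp.degree_eq_zero_iff]
  constructor
  · exact fun h => h.1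
  · rintro rfl; simp

theorem hsymm_zero : hsymm R 0 = 1 := by
  classical
  apply Subtype.ext
  ext m
  rw [coeff_hsymm, Subalgebra.coe_one, coeff_one]
  exact if_congr (Finsupp.degree_eq_zero_iff _) rfl rfl

theorem sum_esymm_mul_hsymm {k : ℕ} (hk : k ≠ 0) :
    ∑ p ∈ Finset.HasAntidiagonal.antidiagonal k, (-1) ^ p.1 * (esymm R p.1 * hsymm R p.2) = 0 := by
  classical
  apply Subtype.ext
  ext m
  have h1 : ∀ p : ℕ × ℕ, coeff m (((-1) ^ p.1 * (esymm R p.1 * hsymm R p.2) : SymFunc R) :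
      MvPowerSeries ℕ R) = ∑ q ∈ Finset.HasAntidiagonal.antidiagonal m,
        if (q.1.degree, q.2.degree) = p then (if ∀ i, q.1 i ≤ 1 then (-1) ^ q.1.degree else 0)
          else 0 := by
    intro p
    have : (((-1) ^ p.1 * (esymm R p.1 * hsymm R p.2) : SymFunc R) : MvPowerSeries ℕ R) =
        C ((-1) ^ p.1) * ((esymm R p.1 : MvPowerSeries ℕ R) * (hsymm R p.2 : MvPowerSeries ℕ R)) := by
      simp
    rw [this, coeff_C_mul, coeff_mul, Finset.mul_sum]
    refine Finset.sum_congr rfl fun q _ => ?_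
    rw [coeff_esymm, coeff_hsymm]
    obtain ⟨p1, p2⟩ := p
    simp only [Prod.mk.injEq]
    by_cases ha : q.1.degree = p1 <;> by_cases hb : q.2.degree = p2 <;> simp [ha, hb]
  rw [AddSubmonoidClass.coe_finsetSum, map_sum, Finset.sum_congr rfl fun p _ => h1 p,
    Finset.sum_comm, ZeroMemClass.coe_zero, map_zero]
  simp only [Finset.sum_ite_eq, Finset.HasAntidiagonal.mem_antidiagonal]
  by_cases hm : m.degree = k
  · have hne : m.support.Nonempty := by
      rw [support_nonempty_iff]; rintro rfl; simp at hm; omega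
    have h2 := Finset.sum_powerset_neg_one_pow_card_of_nonempty hne
    have h3 : (∑ t ∈ m.support.powerset, (-1 : R) ^ t.card) = 0 := by
      exact_mod_cast congrArg (Int.cast : ℤ → R) h2
    have h4 : ∀ q ∈ Finset.HasAntidiagonal.antidiagonal m, q.1.degree + q.2.degree = k := by
      intro q hq
      rw [Finset.HasAntidiagonal.mem_antidiagonal] at hq
      rw [← hm, ← hq, map_add]
    rw [Finset.sum_congr rfl fun q hq => if_pos (h4 q hq), ← Finset.sum_filter, ← h3]
    have hind : ∀ (t : Finset ℕ) i, (∑ j ∈ t, single j 1 : ℕ →₀ ℕ) i = if i ∈ t then 1 else 0 := by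
      intro t i; simp [Finsupp.finsetSum_apply, single_apply]
    refine Finset.sum_bij' (fun q _ => q.1.support)
      (fun t _ => (∑ j ∈ t, single j 1, m - ∑ j ∈ t, single j 1)) ?_ ?_ ?_ ?_ ?_
    · intro q hq
      simp only [Finset.mem_filter, Finset.HasAntidiagonal.mem_antidiagonal] at hq
      rw [Finset.mem_powerset, ← hq.1]
      exact support_mono (le_self_add)
    · intro t ht
      rw [Finset.mem_powerset] at ht
      simp only [Finset.mem_filter, Finset.HasAntidiagonal.mem_antidiagonal]
      refine ⟨add_tsub_cancel_of_le fun i => ?_, fun i => ?_⟩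
      · rw [hind]; split_ifs with h
        · exact Nat.one_le_iff_ne_zero.2 (mem_support_iff.1 (ht h))
        · simp
      · rw [hind]; split_ifs <;> simp
    · intro q hq
      simp only [Finset.mem_filter, Finset.HasAntidiagonal.mem_antidiagonal] at hq
      have h5 : ∑ j ∈ q.1.support, single j 1 = q.1 := by
        ext i
        rw [hind]
        have := hq.2 i
        by_cases h0 : q.1 i = 0
        · simp [h0]
        · rw [if_pos (by simpa using h0)]; omega
      ext1
      · exact h5
      · simp only [h5]
        rw [← hq.1, add_tsub_cancel_left]
    · intro t ht
      ext i
      simp [hind]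
    · intro q hq
      simp only [Finset.mem_filter] at hq
      congr 1
      rw [Finsupp.degree_apply, Finset.card_eq_sum_ones]
      refine Finset.sum_congr rfl fun i hi => ?_
      have := hq.2 i
      have := mem_support_iff.1 hi
      omega
  · refine Finset.sum_eq_zero fun q hq => if_neg fun h => hm ?_
    rw [Finset.HasAntidiagonal.mem_antidiagonal] at hq
    rw [← hq, map_add, h]

theorem neg_one_pow_mul_self {A : Type*} [CommRing A] (k : ℕ) :
    (-1 : A) ^ k * (-1) ^ k = 1 := by
  rw [← pow_add, ← two_mul, pow_mul, neg_one_sq, one_pow]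

variable (R) in
/-- There is exactly one algebra endomorphism of `Λ_R` that sends each `h_k` to `e_k`. -/
theorem existsUnique_omega : ∃! w : SymFunc R →ₐ[R] SymFunc R, ∀ k, w (hsymm R k) = esymm R k := by
  let e : MvPolynomial ℕ R ≃ₐ[R] SymFunc R :=
    AlgEquiv.ofBijective (ofEsymm R) ⟨ofEsymm_injective, ofEsymm_surjective⟩
  let w : SymFunc R →ₐ[R] SymFunc R :=
    (MvPolynomial.aeval fun i => hsymm R (i + 1)).comp (e.symm : SymFunc R →ₐ[R] MvPolynomial ℕ R)
  have hwe : ∀ k, w (esymm R k) = hsymm R k := by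
    rintro (_ | k)
    · rw [esymm_zero, hsymm_zero, map_one]
    · have h : e (MvPolynomial.X k) = esymm R (k + 1) := by
        simp [e, ofEsymm]
      simp [w, ← h]
  have hwh : ∀ k, w (hsymm R k) = esymm R k := by
    intro k
    induction k using Nat.strong_induction_on with
    | _ k ih =>
      rcases Nat.eq_zero_or_pos k with rfl | hk
      · rw [esymm_zero, hsymm_zero, map_one]
      obtain ⟨k, rfl⟩ : ∃ j, k = j + 1 := ⟨k - 1, by omega⟩
      have h1 := congrArg w (sum_esymm_mul_hsymm (R := R) hk.ne')
      simp only [map_sum, map_mul, map_pow, map_neg, map_one, hwe, map_zero] at h1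
      have h2 : ∑ p ∈ Finset.HasAntidiagonal.antidiagonal (k + 1),
          (-1) ^ p.1 * (hsymm R p.1 * esymm R p.2) = 0 := by
        have h3 := sum_esymm_mul_hsymm (R := R) hk.ne'
        rw [← Finset.Nat.sum_antidiagonal_swap] at h3
        have h4 := congrArg (fun x => (-1) ^ (k + 1) * x) h3
        simp only [mul_zero, Finset.mul_sum] at h4
        rw [← h4]
        refine Finset.sum_congr rfl fun p hp => ?_
        rw [Finset.HasAntidiagonal.mem_antidiagonal] at hp
        rw [← hp, pow_add]
        have : ((-1 : SymFunc R) ^ p.2) * (-1) ^ p.2 = 1 :=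
          neg_one_pow_mul_self p.2
        simp only [Prod.fst_swap, Prod.snd_swap]
        linear_combination (-(-1) ^ p.1 * (hsymm R p.1 * esymm R p.2)) * this
      rw [Finset.Nat.antidiagonal_succ, Finset.sum_cons, Finset.sum_map] at h1 h2
      have h5 : ∀ p ∈ Finset.HasAntidiagonal.antidiagonal k,
          w (hsymm R p.2) = esymm R p.2 := by
        intro p hp
        rw [Finset.HasAntidiagonal.mem_antidiagonal] at hp
        exact ih _ (by omega)
      rw [Finset.sum_congr rfl fun p hp => by
        rw [show ((Function.Embedding.prodMap ⟨Nat.succ, Nat.succ_injective⟩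
          (Function.Embedding.refl ℕ)) p).2 = p.2 from rfl, h5 p hp]] at h1
      have h6 := h1.trans h2.symm
      have h7 := add_right_cancel h6
      simpa [hsymm_zero] using h7
  have hww : ∀ f, w (w f) = f := by
    intro f
    obtain ⟨P, rfl⟩ := ofEsymm_surjective f
    have : (w.comp w).comp (ofEsymm R) = ofEsymm R :=
      MvPolynomial.algHom_ext fun i => by simp [ofEsymm, hwe, hwh]
    exact DFunLike.congr_fun this P
  refine ⟨w, hwh, fun w' hw' => ?_⟩
  have hid : ∀ f, w' (w f) = f := by
    intro f
    obtain ⟨P, rfl⟩ := ofEsymm_surjective f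
    have : (w'.comp w).comp (ofEsymm R) = ofEsymm R :=
      MvPolynomial.algHom_ext fun i => by simp [ofEsymm, hwe, hw']
    exact DFunLike.congr_fun this P
  refine AlgHom.ext fun f => ?_
  calc w' f = w' (w (w f)) := by rw [hww]
    _ = w f := hid _

variable (R) in
/-- The involution `ω` on `Λ_R`: the algebra endomorphism that sends each `h_k` to `e_k`. -/
def omegaInvolution : SymFunc R →ₐ[R] SymFunc R := (existsUnique_omega R).choose

theorem omegaInvolution_hsymm (k : ℕ) : omegaInvolution R (hsymm R k) = esymm R k :=
  (existsUnique_omega R).choose_spec.1 k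

variable (R) in
/-- `p_μ`, the product of the `p_{μ_i}` over the parts of `μ`. -/
def psumPart {n : ℕ} (μ : n.Partition) : SymFunc R := (μ.parts.map (psum R)).prod

/-- `z_μ = ∏_i m_i(μ)! i ^ {m_i(μ)}`, where `m_i(μ)` is the multiplicity of `i` in `μ`. -/
def zPart {n : ℕ} (μ : n.Partition) : ℕ :=
  ∏ i ∈ μ.parts.toFinset, (μ.parts.count i).factorial * i ^ μ.parts.count i

/-- A homogeneous symmetric function of degree `n` with coefficients in `ℚ[t]` is `p`-positive if its expansion
in the `p_μ`, `μ ⊢ n`, has polynomials in `t` with nonnegative coefficients as coefficients, i.e. if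
the coefficient of each power of `t` is a `p`-positive symmetric function over `ℚ`. -/
def IsPPositive (n : ℕ) (f : SymFunc (Polynomial ℚ)) : Prop :=
  ∃ c : n.Partition → Polynomial ℚ, (∀ μ j, 0 ≤ (c μ).coeff j) ∧
    f = ∑ μ : n.Partition, c μ • psumPart (Polynomial ℚ) μ

section Digraph

variable {V : Type*} [Fintype V]

/-- A proper colouring of a digraph is a proper colouring of its underlying undirected graph. -/
def IsProper (D : Digraph V) (κ : V → ℕ) : Prop :=
  ∀ u v, D.toSimpleGraphInclusive.Adj u v → κ u ≠ κ v

open Classical in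
/-- `asc(κ)`: the number of directed edges `(u, v)` with `κ(u) < κ(v)`. -/
def asc (D : Digraph V) (κ : V → ℕ) : ℕ :=
  (Finset.univ.filter fun e : V × V => D.Adj e.1 e.2 ∧ κ e.1 < κ e.2).card

/-- The exponent vector of the monomial `x_κ = ∏_v x_{κ(v)}`. -/
def colorExponent (κ : V → ℕ) : ℕ →₀ ℕ := ∑ v, Finsupp.single (κ v) 1

open Classical in
/-- The chromatic quasisymmetric function `∑_κ t ^ asc(κ) x_κ` over all proper colourings `κ`, as a
power series over `ℚ[t]`. The coefficient of `x ^ m` sums over the proper colourings with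
`x_κ = x ^ m`; these take only colours in the support of `m`. -/
def chromaticQSym (D : Digraph V) : MvPowerSeries ℕ (Polynomial ℚ) := fun m =>
  ∑ κ ∈ (Fintype.piFinset fun _ : V => m.support).filter
    (fun κ => IsProper D κ ∧ colorExponent κ = m), Polynomial.X ^ asc D κ

end Digraph

section Permutation

variable {n : ℕ}

open Classical in
/-- `inv_D(σ)`: the number of directed edges `(u, v)` such that `v` precedes `u` in the word
`σ(0) σ(1) ⋯ σ(n-1)`. -/
def digraphInv (D : Digraph (Fin n)) (σ : Equiv.Perm (Fin n)) : ℕ :=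
  (Finset.univ.filter fun e : Fin n × Fin n =>
    D.Adj e.1 e.2 ∧ σ.symm e.2 < σ.symm e.1).card

/-- The `(G, σ)`-rank of `x`: the length of the longest subword of `σ` that ends in `x` and whose
consecutive letters are adjacent in `G`. A subword is given by the list `l` of its positions. -/
def graphRank (G : SimpleGraph (Fin n)) (σ : Equiv.Perm (Fin n)) (x : Fin n) : ℕ :=
  sSup {k | ∃ l : List (Fin n), l.length = k ∧
    l.IsChain (fun i j => i < j ∧ G.Adj (σ i) (σ j)) ∧ l.getLast? = some (σ.symm x)}

/-- `σ` has a `G`-descent at position `i`, i.e. between the positions `i` and `i + 1`. -/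
def IsGDescent (G : SimpleGraph (Fin n)) (σ : Equiv.Perm (Fin n)) (i : Fin n) : Prop :=
  ∃ j : Fin n, (j : ℕ) = i + 1 ∧
    (graphRank G σ (σ j) < graphRank G σ (σ i) ∨
      graphRank G σ (σ i) = graphRank G σ (σ j) ∧ σ j < σ i)

/-- The letter at position `j` is a `G`-isolated letter of the segment of `σ` that starts at
position `a`: it is not the first letter of the segment, and no earlier letter of the segment is
adjacent to it. -/
def IsGIsolated (G : SimpleGraph (Fin n)) (σ : Equiv.Perm (Fin n)) (a : ℕ) (j : Fin n) : Prop :=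
  a < j ∧ ∀ k : Fin n, a ≤ k → k < j → ¬ G.Adj (σ k) (σ j)

/-- `s_i = μ_1 + ⋯ + μ_i`, where `μ_1 ≥ μ_2 ≥ ⋯` are the parts of `μ`. -/
def partialSum (μ : n.Partition) (i : ℕ) : ℕ := ((μ.parts.sort (· ≥ ·)).take i).sum

open Classical in
/-- `N_μ(G)`: the permutations `σ` such that, when `σ` is cut into contiguous segments of lengths
`μ_1, μ_2, …`, no segment has a `G`-isolated letter or contains a `G`-descent of `σ`.
The `i`-th segment, `i = 0, 1, …`, occupies the positions `j` with `s_i ≤ j < s_{i+1}`. -/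
def NSet (μ : n.Partition) (G : SimpleGraph (Fin n)) : Finset (Equiv.Perm (Fin n)) :=
  Finset.univ.filter fun σ => ∀ i < μ.parts.card,
    (∀ j : Fin n, partialSum μ i ≤ j → (j : ℕ) < partialSum μ (i + 1) →
      ¬ IsGIsolated G σ (partialSum μ i) j) ∧
    (∀ j : Fin n, partialSum μ i ≤ j → (j : ℕ) + 1 < partialSum μ (i + 1) →
      ¬ IsGDescent G σ j)

end Permutation

end ChromQSym

end

/-!
The coefficient of `p_μ` in a symmetric function `f` is `z_μ⁻¹ ⟨f, p_μ⟩` for the Hall inner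
product. Since `⟨f, h_α⟩` is the coefficient of `x ^ α` in `f` and
`p_k = ∑_α (-1) ^ (ℓ(α) + 1) α₁ h_α` over the compositions `α` of `k`, the pairing with `p_μ` is a
signed sum of coefficients, which makes sense for every power series. Both on the `p_ρ` and on the
chromatic quasisymmetric function it becomes a signed sum over labelings that increase along an
acyclic relation (the empty one for `p_ρ`, an acyclic orientation of the graph for a class of
colorings). Removing the elements with the smallest label, which form a set of sources, lets all
these terms cancel except those from ordered partitions whose blocks have one source each. For
`p_ρ` they contribute `z_μ` if `ρ = μ`, and do not exist otherwise. For the chromatic function, an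
acyclic orientation together with such an ordered partition is the same as an element of `N_μ`:
sort each block by rank and then by label. Only the sign `(-1) ^ (n - ℓ(μ))` remains, and
`ω p_μ = (-1) ^ (n - ℓ(μ)) p_μ` cancels it.
-/

noncomputable section

namespace ChromQSym

open MvPowerSeries Finsupp

section Packed

variable {J : Type*} {R : Type*} [CommRing R]

theorem neg_one_pow_card_sdiff [DecidableEq J] {S U : Finset J} (h : S ⊆ U) :
    (-1 : R) ^ (U \ S).card = (-1) ^ U.card * (-1) ^ S.card := by
  rw [← Finset.card_sdiff_add_card_eq_card h, pow_add, mul_assoc, neg_one_pow_mul_self, mul_one]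

theorem sum_powerset_neg_one_pow_card {M : Finset J} (hM : M.Nonempty) :
    ∑ S ∈ M.powerset, (-1 : R) ^ S.card = 0 := by
  exact_mod_cast congrArg (Int.cast : ℤ → R) (Finset.sum_powerset_neg_one_pow_card_of_nonempty hM)

theorem sum_powerset_neg_one_pow_card_mul_sum (M : Finset J) (ν : J → R) :
    ∑ S ∈ M.powerset, (-1) ^ S.card * ∑ j ∈ S, ν j =
      if M.card = 1 then -∑ j ∈ M, ν j else 0 := by
  classical
  induction M using Finset.induction_on with
  | empty => simp
  | insert a M ha ih =>
    have hinsert : ∀ S ∈ M.powerset, (-1 : R) ^ (insert a S).card * ∑ j ∈ insert a S, ν j =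
        -((-1) ^ S.card * ν a) - (-1) ^ S.card * ∑ j ∈ S, ν j := by
      intro S hS
      have haS : a ∉ S := fun h => ha (Finset.mem_powerset.1 hS h)
      rw [Finset.card_insert_of_notMem haS, Finset.sum_insert haS]
      ring
    rw [Finset.sum_powerset_insert ha, Finset.sum_congr rfl hinsert, Finset.sum_sub_distrib,
      Finset.sum_neg_distrib, ← Finset.sum_mul, Finset.card_insert_of_notMem ha]
    rcases M.eq_empty_or_nonempty with rfl | hM
    · simp
    · have := hM.card_pos
      rw [sum_powerset_neg_one_pow_card hM, if_neg (by omega : ¬ M.card + 1 = 1)]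
      ring

open Classical in
/-- The elements of `U` with no `o`-predecessor in `U`. -/
def sources (o : J → J → Prop) (U : Finset J) : Finset J := U.filter fun v => ∀ u ∈ U, ¬ o u v

theorem mem_sources {o : J → J → Prop} {U : Finset J} {v : J} :
    v ∈ sources o U ↔ v ∈ U ∧ ∀ u ∈ U, ¬ o u v := by
  simp [sources]

theorem sources_subset (o : J → J → Prop) (U : Finset J) : sources o U ⊆ U :=
  fun _ h => (mem_sources.1 h).1

theorem sources_nonempty {o : J → J → Prop} (ho : WellFounded o) {U : Finset J}
    (hU : U.Nonempty) : (sources o U).Nonempty := by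
  obtain ⟨v, hv, hmin⟩ := ho.has_min (U : Set J) hU
  exact ⟨v, mem_sources.2 ⟨hv, hmin⟩⟩

/-- The weight of the only source of `U`, or `0` if `U` does not have exactly one source. -/
def sourceWeight (o : J → J → Prop) (ν : J → ℕ) (U : Finset J) : ℕ :=
  if (sources o U).card = 1 then ∑ j ∈ sources o U, ν j else 0

/-- A packed labeling of `U`: the labels are positive exactly on `U`, they are strictly increasing
along `o`, and the positive ones form an initial segment of the positive integers. -/
structure IsPacked (o : J → J → Prop) (U : Finset J) (ψ : J → ℕ) : Prop where
  ne_zero_iff (j : J) : ψ j ≠ 0 ↔ j ∈ U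
  Icc_subset_range (j : J) : Set.Icc 1 (ψ j) ⊆ Set.range ψ
  lt {u v : J} : u ∈ U → v ∈ U → o u v → ψ u < ψ v

theorem le_card_of_Icc_subset_range [Fintype J] {ψ : J → ℕ} {a : ℕ}
    (h : Set.Icc 1 a ⊆ Set.range ψ) : a ≤ Fintype.card J := by
  classical
  have himage : Finset.Icc 1 a ⊆ Finset.univ.image ψ := fun b hb => by
    simpa using h (Finset.mem_Icc.1 hb)
  simpa using (Finset.card_le_card himage).trans Finset.card_image_le

variable {o : J → J → Prop} {U S : Finset J} {ψ : J → ℕ}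

theorem IsPacked.eq_zero_iff (h : IsPacked o U ψ) (j : J) : ψ j = 0 ↔ j ∉ U := by
  rw [← h.ne_zero_iff, not_not]

/-- Undoes the subtraction of `1` from all the labels of a packed labeling of `U`. -/
def raise [DecidableEq J] (U : Finset J) (ψ : J → ℕ) (j : J) : ℕ := if j ∈ U then ψ j + 1 else 0

theorem IsPacked.raise_pred [DecidableEq J] (h : IsPacked o U ψ) :
    raise U (fun j => ψ j - 1) = ψ := by
  ext j
  have := h.ne_zero_iff j
  grind [raise]

theorem IsPacked.pred_raise [DecidableEq J] (h : IsPacked o (U \ S) ψ) :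
    (fun j => raise U ψ j - 1) = ψ := by
  ext j
  have := h.ne_zero_iff j
  grind [raise]

theorem IsPacked.isPacked_raise [DecidableEq J] (h : IsPacked o (U \ S) ψ) (hS : S.Nonempty)
    (hSU : S ⊆ sources o U) : IsPacked o U (raise U ψ) where
  ne_zero_iff j := by simp [raise]
  Icc_subset_range j a := by
    rintro ⟨ha, haj⟩
    obtain rfl | ha := ha.eq_or_lt
    · obtain ⟨s, hs⟩ := hS
      have hψs : ψ s = 0 := (h.eq_zero_iff s).2 (by simp [hs])
      exact ⟨s, by simp [raise, hψs, sources_subset _ _ (hSU hs)]⟩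
    · have haj : a ≤ ψ j + 1 := haj.trans (by unfold raise; split_ifs <;> omega)
      obtain ⟨i, hi⟩ := h.Icc_subset_range j (show a - 1 ∈ Set.Icc 1 (ψ j) from
        ⟨by omega, by omega⟩)
      have hiU : i ∈ U := (Finset.mem_sdiff.1 ((h.ne_zero_iff i).1 (by omega))).1
      exact ⟨i, by rw [raise, if_pos hiU, hi]; omega⟩
  lt {u v} hu hv huv := by
    rw [raise, raise, if_pos hu, if_pos hv]
    have hv' : v ∈ U \ S := Finset.mem_sdiff.2 ⟨hv, fun h => (mem_sources.1 (hSU h)).2 u hu huv⟩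
    by_cases huS : u ∈ S
    · have := (h.eq_zero_iff u).2 (by simp [huS])
      have := (h.ne_zero_iff v).2 hv'
      omega
    · exact Nat.succ_lt_succ (h.lt (Finset.mem_sdiff.2 ⟨hu, huS⟩) hv' huv)

variable [Fintype J]

/-- The set of the elements with the label `1`. -/
def firstClass (ψ : J → ℕ) : Finset J := Finset.univ.filter fun j => ψ j = 1

@[simp] theorem mem_firstClass {j : J} : j ∈ firstClass ψ ↔ ψ j = 1 := by simp [firstClass]

theorem IsPacked.firstClass_nonempty (h : IsPacked o U ψ) (hU : U.Nonempty) :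
    (firstClass ψ).Nonempty := by
  obtain ⟨j, hj⟩ := hU
  obtain ⟨i, hi⟩ := h.Icc_subset_range j ⟨le_rfl, Nat.pos_of_ne_zero ((h.ne_zero_iff j).2 hj)⟩
  exact ⟨i, mem_firstClass.2 hi⟩

theorem IsPacked.firstClass_subset_sources (h : IsPacked o U ψ) : firstClass ψ ⊆ sources o U := by
  intro v hv
  rw [mem_firstClass] at hv
  have hvU : v ∈ U := (h.ne_zero_iff v).1 (by omega)
  refine mem_sources.2 ⟨hvU, fun u hu huv => (h.ne_zero_iff u).2 hu ?_⟩
  have := h.lt hu hvU huv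
  omega

theorem IsPacked.isPacked_pred [DecidableEq J] (h : IsPacked o U ψ) :
    IsPacked o (U \ firstClass ψ) fun j => ψ j - 1 where
  ne_zero_iff j := by
    rw [Finset.mem_sdiff, mem_firstClass, ← h.ne_zero_iff]
    omega
  Icc_subset_range j a := by
    rintro ⟨ha, haj⟩
    obtain ⟨i, hi⟩ := h.Icc_subset_range j (show a + 1 ∈ Set.Icc 1 (ψ j) from ⟨by omega, by omega⟩)
    exact ⟨i, by simp [hi]⟩
  lt {u v} hu hv huv := by
    rw [Finset.mem_sdiff, mem_firstClass] at hu hv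
    have := h.lt hu.1 hv.1 huv
    have := (h.ne_zero_iff u).2 hu.1
    omega

theorem IsPacked.firstClass_raise [DecidableEq J] (h : IsPacked o (U \ S) ψ) (hSU : S ⊆ U) :
    firstClass (raise U ψ) = S := by
  ext j
  have hj := h.ne_zero_iff j
  have := @hSU j
  rw [Finset.mem_sdiff] at hj
  simp only [mem_firstClass, raise]
  grind

open Classical in
/-- The packed labelings of `U`; the bound on the labels is implied by `IsPacked`. -/
def packed (o : J → J → Prop) (U : Finset J) : Finset (J → ℕ) :=
  (Fintype.piFinset fun _ => Finset.range (Fintype.card J + 1)).filter (IsPacked o U)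

@[simp] theorem mem_packed : ψ ∈ packed o U ↔ IsPacked o U ψ := by
  classical
  rw [packed, Finset.mem_filter, and_iff_right_iff_imp]
  intro h
  simpa [Nat.lt_succ_iff] using fun j => le_card_of_Icc_subset_range (h.Icc_subset_range j)

theorem packed_empty (o : J → J → Prop) : packed o ∅ = {0} := by
  ext ψ
  rw [mem_packed, Finset.mem_singleton]
  constructor
  · intro h
    ext j
    simpa using h.eq_zero_iff j
  · rintro rfl
    exact ⟨by simp, fun j a ha => by simp at ha, by simp⟩

/-- The largest label. -/
def height (ψ : J → ℕ) : ℕ := Finset.univ.sup ψ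

theorem le_height (ψ : J → ℕ) (j : J) : ψ j ≤ height ψ := Finset.le_sup (Finset.mem_univ j)

theorem height_zero : height (0 : J → ℕ) = 0 := Finset.sup_bot _

theorem height_pred (ψ : J → ℕ) : height (fun j => ψ j - 1) = height ψ - 1 := by
  apply le_antisymm
  · exact Finset.sup_le fun j _ => Nat.sub_le_sub_right (le_height ψ j) 1
  · rw [Nat.sub_le_iff_le_add]
    exact Finset.sup_le fun j _ => Nat.sub_le_iff_le_add.1 (le_height (fun j => ψ j - 1) j)

open Classical in
/-- Deleting the first class of a packed labeling lowers its height by one. -/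
theorem sum_packed_firstClass_eq (hS : S.Nonempty) (hSU : S ⊆ sources o U) :
    ∑ ψ ∈ (packed o U).filter (fun ψ => firstClass ψ = S), (-1 : R) ^ height ψ =
      -∑ ψ ∈ packed o (U \ S), (-1) ^ height ψ := by
  rw [← Finset.sum_neg_distrib]
  refine Finset.sum_bij' (fun ψ _ j => ψ j - 1) (fun ψ _ => raise U ψ) ?_ ?_ ?_ ?_ ?_
  · intro ψ hψ
    obtain ⟨hpacked, rfl⟩ := Finset.mem_filter.1 hψ
    exact mem_packed.2 (mem_packed.1 hpacked).isPacked_pred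
  · intro ψ hψ
    rw [mem_packed] at hψ
    exact Finset.mem_filter.2 ⟨mem_packed.2 (hψ.isPacked_raise hS hSU),
      hψ.firstClass_raise (hSU.trans (sources_subset o U))⟩
  · exact fun ψ hψ => (mem_packed.1 (Finset.mem_filter.1 hψ).1).raise_pred
  · exact fun ψ hψ => (mem_packed.1 hψ).pred_raise
  · intro ψ hψ
    obtain ⟨-, rfl⟩ := Finset.mem_filter.1 hψ
    obtain ⟨s, hs⟩ := hS
    have hpos : 1 ≤ height ψ := (mem_firstClass.1 hs).symm.le.trans (le_height ψ s)
    rw [height_pred, ← Nat.sub_add_cancel hpos, Nat.add_sub_cancel, pow_succ, mul_neg_one]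

open Classical in
theorem sum_packed_mul_firstClass (o : J → J → Prop) (hU : U.Nonempty) (F : Finset J → R) :
    ∑ ψ ∈ packed o U, (-1) ^ height ψ * F (firstClass ψ) =
      -∑ S ∈ (sources o U).powerset.erase ∅, F S * ∑ ψ ∈ packed o (U \ S), (-1) ^ height ψ := by
  have hmaps : ∀ ψ ∈ packed o U, firstClass ψ ∈ (sources o U).powerset.erase ∅ := by
    intro ψ hψ
    rw [mem_packed] at hψ
    exact Finset.mem_erase.2 ⟨(hψ.firstClass_nonempty hU).ne_empty,
      Finset.mem_powerset.2 hψ.firstClass_subset_sources⟩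
  rw [← Finset.sum_fiberwise_of_maps_to hmaps, ← Finset.sum_neg_distrib]
  refine Finset.sum_congr rfl fun S hS => ?_
  obtain ⟨hne, hSU⟩ := Finset.mem_erase.1 hS
  rw [← mul_neg, ← sum_packed_firstClass_eq (Finset.nonempty_iff_ne_empty.2 hne)
    (Finset.mem_powerset.1 hSU), Finset.mul_sum]
  exact Finset.sum_congr rfl fun ψ hψ => by rw [(Finset.mem_filter.1 hψ).2, mul_comm]

theorem sum_packed (ho : WellFounded o) (U : Finset J) :
    ∑ ψ ∈ packed o U, (-1 : R) ^ height ψ = (-1) ^ U.card := by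
  classical
  induction U using Finset.strongInduction with
  | H U ih =>
    rcases U.eq_empty_or_nonempty with rfl | hU
    · simp [packed_empty, height_zero]
    have hrec : ∀ S ∈ (sources o U).powerset.erase ∅,
        ∑ ψ ∈ packed o (U \ S), (-1 : R) ^ height ψ = (-1) ^ U.card * (-1) ^ S.card := by
      intro S hS
      obtain ⟨hne, hS⟩ := Finset.mem_erase.1 hS
      have hSU := (Finset.mem_powerset.1 hS).trans (sources_subset o U)
      rw [ih _ (Finset.sdiff_ssubset hSU (Finset.nonempty_iff_ne_empty.2 hne)),
        neg_one_pow_card_sdiff hSU]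
    have hclass := sum_packed_mul_firstClass o hU fun _ => (1 : R)
    simp only [mul_one, one_mul] at hclass
    rw [hclass, Finset.sum_congr rfl hrec, ← Finset.mul_sum,
      Finset.sum_erase_eq_sub (Finset.empty_mem_powerset _),
      sum_powerset_neg_one_pow_card (sources_nonempty ho hU)]
    simp

theorem sum_packed_mul_sum_firstClass (ho : WellFounded o) (ν : J → ℕ) (U : Finset J) :
    ∑ ψ ∈ packed o U, (-1 : R) ^ (height ψ + 1) * (∑ j ∈ firstClass ψ, ν j : ℕ) =
      (-1) ^ (U.card + 1) * (sourceWeight o ν U : R) := by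
  classical
  rcases U.eq_empty_or_nonempty with rfl | hU
  · simp [packed_empty, firstClass, sourceWeight, sources]
  have hterm : ∀ S ∈ (sources o U).powerset.erase ∅, ((∑ j ∈ S, ν j : ℕ) : R) *
      ∑ ψ ∈ packed o (U \ S), (-1 : R) ^ height ψ =
      (-1) ^ U.card * ((-1) ^ S.card * ∑ j ∈ S, (ν j : R)) := by
    intro S hS
    have hSU := Finset.mem_powerset.1 (Finset.mem_erase.1 hS).2
    rw [sum_packed ho, neg_one_pow_card_sdiff (hSU.trans (sources_subset o U))]
    push_cast
    ring
  simp only [pow_succ, mul_neg_one, neg_mul, Finset.sum_neg_distrib]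
  rw [sum_packed_mul_firstClass o hU fun S => ((∑ j ∈ S, ν j : ℕ) : R), neg_neg,
    Finset.sum_congr rfl hterm, ← Finset.mul_sum,
    Finset.sum_erase_eq_sub (Finset.empty_mem_powerset _), sum_powerset_neg_one_pow_card_mul_sum,
    sourceWeight]
  split_ifs <;> simp

end Packed

section Rows

variable {ι : Type*} {N : ℕ} {J : Type*}

open Classical in
/-- The weight of a row `m` of exponents, which is nonzero only if the row is a composition of `k`
followed by zeros: it is the coefficient `(-1) ^ (ℓ + 1) * α₁` of `h_α` in `p_k`, where `α` is that
composition and `ℓ` its length. -/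
def rowWeight (k : ℕ) (m : Fin (N + 1) → ℕ) : ℤ :=
  if IsLowerSet (Function.support m) ∧ ∑ a, m a = k then
    (-1) ^ ((Finset.univ.filter fun a => m a ≠ 0).card + 1) * (m 0 : ℤ)
  else 0

/-- The row of a map to the cells. -/
def rowOf (ψ : J → ι ×ₗ Fin (N + 1)) (j : J) : ι := (ofLex (ψ j)).1

theorem eq_toLex_iff {ψ : J → ι ×ₗ Fin (N + 1)} {i : ι} {a : Fin (N + 1)} {j : J} :
    ψ j = toLex (i, a) ↔ rowOf ψ j = i ∧ (ofLex (ψ j)).2 = a :=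
  Prod.ext_iff

section Content

variable [Fintype J] {I : Type*} {ν : J → ℕ}

/-- The weighted content of a map `ψ`: the exponent of the monomial `∏ j, x_{ψ j} ^ ν j`. -/
def content (ν : J → ℕ) (ψ : J → I) : I →₀ ℕ := ∑ j, Finsupp.single (ψ j) (ν j)

theorem content_apply [DecidableEq I] (ν : J → ℕ) (ψ : J → I) (x : I) :
    content ν ψ x = ∑ j ∈ Finset.univ.filter fun j => ψ j = x, ν j := by
  rw [content, Finsupp.finsetSum_apply, Finset.sum_filter]
  exact Finset.sum_congr rfl fun j _ => Finsupp.single_apply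

theorem degree_content (ν : J → ℕ) (ψ : J → I) : (content ν ψ).degree = ∑ j, ν j := by
  simp [content]

theorem content_apply_ne_zero (hν : ∀ j, 0 < ν j) (ψ : J → I) (x : I) :
    content ν ψ x ≠ 0 ↔ ∃ j, ψ j = x := by
  classical
  simp [content_apply, Finset.sum_eq_zero_iff, (hν _).ne']

theorem sum_content_row [DecidableEq ι] (ν : J → ℕ) (ψ : J → ι ×ₗ Fin (N + 1)) (i : ι) :
    ∑ a, content ν ψ (toLex (i, a)) = ∑ j ∈ Finset.univ.filter fun j => rowOf ψ j = i, ν j := by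
  rw [← Finset.sum_fiberwise (g := fun j => (ofLex (ψ j)).2)]
  simp only [content_apply, Finset.filter_filter, eq_toLex_iff]

end Content

variable [LinearOrder ι]

/-- The labels of the row `i` of a map to the cells `(i, a)`: the label is `a + 1` on that row, and
`0` off that row. -/
def rowLabel (ψ : J → ι ×ₗ Fin (N + 1)) (i : ι) (j : J) : ℕ :=
  if rowOf ψ j = i then (ofLex (ψ j)).2 + 1 else 0

theorem rowLabel_eq_succ (ψ : J → ι ×ₗ Fin (N + 1)) (i : ι) (j : J) (a : Fin (N + 1)) :
    rowLabel ψ i j = a + 1 ↔ ψ j = toLex (i, a) := by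
  rw [eq_toLex_iff, rowLabel, Fin.ext_iff]
  split_ifs with h <;> simp [h]

theorem rowLabel_ne_zero (ψ : J → ι ×ₗ Fin (N + 1)) (i : ι) (j : J) :
    rowLabel ψ i j ≠ 0 ↔ rowOf ψ j = i := by
  simp [rowLabel]

theorem exists_rowLabel_eq {ψ : J → ι ×ₗ Fin (N + 1)} {i : ι} {j : J} (h : rowLabel ψ i j ≠ 0) :
    ∃ a : Fin (N + 1), rowLabel ψ i j = a + 1 ∧ ψ j = toLex (i, a) :=
  ⟨(ofLex (ψ j)).2, if_pos ((rowLabel_ne_zero ψ i j).1 h),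
    eq_toLex_iff.2 ⟨(rowLabel_ne_zero ψ i j).1 h, rfl⟩⟩

variable [Fintype J]

theorem isLowerSet_support_content_row {ν : J → ℕ} (hν : ∀ j, 0 < ν j)
    (ψ : J → ι ×ₗ Fin (N + 1)) (i : ι) :
    IsLowerSet (Function.support fun a => content ν ψ (toLex (i, a))) ↔
      ∀ j, Set.Icc 1 (rowLabel ψ i j) ⊆ Set.range (rowLabel ψ i) := by
  simp only [IsLowerSet, Function.mem_support, content_apply_ne_zero hν]
  constructor
  · rintro h j b ⟨hb, hbj⟩
    obtain ⟨a, ha, hja⟩ := exists_rowLabel_eq (show rowLabel ψ i j ≠ 0 by omega)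
    obtain ⟨j', hj'⟩ := @h a ⟨b - 1, by omega⟩ (Fin.le_def.2 (by simp only; omega)) ⟨j, hja⟩
    exact ⟨j', by rw [(rowLabel_eq_succ ψ i j' _).2 hj', Nat.sub_add_cancel hb]⟩
  · rintro h a b hba ⟨j, hj⟩
    rw [← rowLabel_eq_succ] at hj
    obtain ⟨j', hj'⟩ := h j (show (b : ℕ) + 1 ∈ Set.Icc 1 (rowLabel ψ i j) from
      ⟨by omega, by rw [hj]; exact Nat.succ_le_succ hba⟩)
    exact ⟨j', (rowLabel_eq_succ ψ i j' b).1 hj'⟩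

theorem card_image_erase_zero {ψ : J → ℕ} (h : ∀ j, Set.Icc 1 (ψ j) ⊆ Set.range ψ) :
    ((Finset.univ.image ψ).erase 0).card = height ψ := by
  suffices (Finset.univ.image ψ).erase 0 = Finset.Icc 1 (height ψ) by simp [this]
  ext a
  simp only [Finset.mem_erase, Finset.mem_image, Finset.mem_univ, true_and, Finset.mem_Icc]
  constructor
  · rintro ⟨h0, j, rfl⟩
    exact ⟨Nat.pos_of_ne_zero h0, le_height ψ j⟩
  · rintro ⟨ha, hle⟩
    obtain ⟨j, -, hj⟩ := (Finset.le_sup_iff (show ⊥ < a from ha)).1 hle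
    exact ⟨by omega, h j ⟨ha, hj⟩⟩

theorem card_support_content_row {ν : J → ℕ} (hν : ∀ j, 0 < ν j) {ψ : J → ι ×ₗ Fin (N + 1)}
    {i : ι} (h : ∀ j, Set.Icc 1 (rowLabel ψ i j) ⊆ Set.range (rowLabel ψ i)) :
    (Finset.univ.filter fun a => content ν ψ (toLex (i, a)) ≠ 0).card = height (rowLabel ψ i) := by
  simp only [← card_image_erase_zero h, content_apply_ne_zero hν]
  refine Finset.card_bij (fun a _ => (a : ℕ) + 1) ?_ (fun a _ b _ hab => Fin.ext (by omega)) ?_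
  · intro a ha
    obtain ⟨j, hj⟩ := (Finset.mem_filter.1 ha).2
    exact Finset.mem_erase.2 ⟨a.val.succ_ne_zero,
      Finset.mem_image.2 ⟨j, Finset.mem_univ j, (rowLabel_eq_succ ψ i j a).2 hj⟩⟩
  · intro b hb
    obtain ⟨hb0, hb⟩ := Finset.mem_erase.1 hb
    obtain ⟨j, -, rfl⟩ := Finset.mem_image.1 hb
    obtain ⟨a, ha, hja⟩ := exists_rowLabel_eq hb0
    exact ⟨a, Finset.mem_filter.2 ⟨Finset.mem_univ a, j, hja⟩, ha.symm⟩

open Classical in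
theorem rowWeight_content {ν : J → ℕ} (hν : ∀ j, 0 < ν j) (ψ : J → ι ×ₗ Fin (N + 1)) (i : ι) :
    rowWeight (∑ j ∈ Finset.univ.filter fun j => rowOf ψ j = i, ν j)
        (fun a => content ν ψ (toLex (i, a))) =
      if ∀ j, Set.Icc 1 (rowLabel ψ i j) ⊆ Set.range (rowLabel ψ i) then
        (-1) ^ (height (rowLabel ψ i) + 1) * ((∑ j ∈ firstClass (rowLabel ψ i), ν j : ℕ) : ℤ)
      else 0 := by
  have hzero : content ν ψ (toLex (i, 0)) = ∑ j ∈ firstClass (rowLabel ψ i), ν j := by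
    simp only [content_apply, firstClass, ← rowLabel_eq_succ, Fin.val_zero, zero_add]
  rw [rowWeight, isLowerSet_support_content_row hν, sum_content_row, hzero]
  simp only [and_true]
  split_ifs with h
  · rw [card_support_content_row hν h]
  · rfl

theorem rowWeight_content_eq_zero {ν : J → ℕ} {ψ : J → ι ×ₗ Fin (N + 1)} {i : ι} {k : ℕ}
    (h : ∑ j ∈ Finset.univ.filter (fun j => rowOf ψ j = i), ν j ≠ k) :
    rowWeight k (fun a => content ν ψ (toLex (i, a))) = 0 := by
  rw [rowWeight, sum_content_row, if_neg fun h' => h h'.2]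

section RowLabels

variable {o : J → J → Prop}

theorem isPacked_rowLabel {ψ : J → ι ×ₗ Fin (N + 1)} (hψ : ∀ u v, o u v → ψ u < ψ v) {i : ι}
    (hi : ∀ j, Set.Icc 1 (rowLabel ψ i j) ⊆ Set.range (rowLabel ψ i)) :
    IsPacked o (Finset.univ.filter fun j => rowOf ψ j = i) (rowLabel ψ i) where
  ne_zero_iff j := by simp [rowLabel_ne_zero]
  Icc_subset_range := hi
  lt {u v} hu hv huv := by
    have hu : rowOf ψ u = i := (Finset.mem_filter.1 hu).2
    have hv : rowOf ψ v = i := (Finset.mem_filter.1 hv).2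
    rw [rowLabel, rowLabel, if_pos hu, if_pos hv]
    rcases Prod.Lex.lt_iff.1 (hψ u v huv) with h | h
    · exact absurd (hu.trans hv.symm) h.ne
    · exact Nat.succ_lt_succ h.2

/-- The map to the cells with the rows `β` and the row labels `p`. -/
def ofRowLabels (N : ℕ) (β : J → ι) (p : ι → J → ℕ) (j : J) : ι ×ₗ Fin (N + 1) :=
  toLex (β j, Fin.ofNat (N + 1) (p (β j) j - 1))

variable {β : J → ι} {p : ι → J → ℕ}

theorem val_ofRowLabels (hN : Fintype.card J ≤ N + 1)
    (hp : ∀ i, IsPacked o (Finset.univ.filter fun j => β j = i) (p i)) (j : J) :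
    ((ofLex (ofRowLabels N β p j)).2 : ℕ) + 1 = p (β j) j := by
  have hpos := ((hp (β j)).ne_zero_iff j).2 (by simp)
  have hle := le_card_of_Icc_subset_range ((hp (β j)).Icc_subset_range j)
  change (p (β j) j - 1) % (N + 1) + 1 = p (β j) j
  rw [Nat.mod_eq_of_lt (by omega)]
  omega

theorem rowLabel_ofRowLabels (hN : Fintype.card J ≤ N + 1)
    (hp : ∀ i, IsPacked o (Finset.univ.filter fun j => β j = i) (p i)) :
    rowLabel (ofRowLabels N β p) = p := by
  ext i j
  rw [rowLabel]
  split_ifs with h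
  · rw [val_ofRowLabels hN hp]
    exact congrArg (p · j) h
  · exact (((hp i).eq_zero_iff j).2 fun hj => h (Finset.mem_filter.1 hj).2).symm

theorem ofRowLabels_lt (hN : Fintype.card J ≤ N + 1) (hβ : ∀ u v, o u v → β u ≤ β v)
    (hp : ∀ i, IsPacked o (Finset.univ.filter fun j => β j = i) (p i)) {u v : J} (huv : o u v) :
    ofRowLabels N β p u < ofRowLabels N β p v := by
  rw [Prod.Lex.lt_iff]
  refine (hβ u v huv).lt_or_eq.imp_right fun (h : β u = β v) => ⟨h, ?_⟩
  have hlt := (hp (β v)).lt (by simp [h]) (by simp) huv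
  rw [← val_ofRowLabels hN hp v, ← h, ← val_ofRowLabels hN hp u] at hlt
  exact Nat.lt_of_succ_lt_succ hlt

variable [Fintype ι]

open Classical in
theorem sum_prod_rowLabel (hN : Fintype.card J ≤ N + 1) (hβ : ∀ u v, o u v → β u ≤ β v)
    (F : (J → ℕ) → ℤ) :
    ∑ ψ : J → ι ×ₗ Fin (N + 1) with (∀ u v, o u v → ψ u < ψ v) ∧ rowOf ψ = β,
      (if ∀ i j, Set.Icc 1 (rowLabel ψ i j) ⊆ Set.range (rowLabel ψ i) then
        ∏ i, F (rowLabel ψ i) else 0) =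
    ∏ i, ∑ ψ ∈ packed o (Finset.univ.filter fun j => β j = i), F ψ := by
  rw [Finset.prod_univ_sum, ← Finset.sum_filter, Finset.filter_filter]
  have hmem : ∀ p : ι → J → ℕ,
      p ∈ Fintype.piFinset (fun i => packed o (Finset.univ.filter fun j => β j = i)) ↔
        ∀ i, IsPacked o (Finset.univ.filter fun j => β j = i) (p i) := by
    simp [Fintype.mem_piFinset]
  refine Finset.sum_bij' (fun ψ _ => rowLabel ψ) (fun p _ => ofRowLabels N β p) ?_ ?_ ?_ ?_ ?_
  · intro ψ hψ
    obtain ⟨-, ⟨hlt, rfl⟩, hfill⟩ := Finset.mem_filter.1 hψ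
    exact (hmem _).2 fun i => isPacked_rowLabel hlt (hfill i)
  · intro p hp
    rw [hmem] at hp
    refine Finset.mem_filter.2
      ⟨Finset.mem_univ _, ⟨fun u v => ofRowLabels_lt hN hβ hp, rfl⟩, fun i j => ?_⟩
    rw [rowLabel_ofRowLabels hN hp]
    exact (hp i).Icc_subset_range j
  · intro ψ hψ
    obtain ⟨-, ⟨-, rfl⟩, -⟩ := Finset.mem_filter.1 hψ
    ext j
    exact eq_comm.1 (eq_toLex_iff.2 ⟨rfl, by simp [rowLabel]⟩)
  · exact fun p hp => rowLabel_ofRowLabels hN ((hmem p).1 hp)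
  · exact fun ψ _ => rfl

open Classical in
theorem sum_prod_rowWeight_of_rowOf_eq (ho : WellFounded o) {ν : J → ℕ} (hν : ∀ j, 0 < ν j)
    (hN : Fintype.card J ≤ N + 1) (μ : ι → ℕ) (hβ : ∀ u v, o u v → β u ≤ β v) :
    ∑ ψ : J → ι ×ₗ Fin (N + 1) with (∀ u v, o u v → ψ u < ψ v) ∧ rowOf ψ = β,
      ∏ i, rowWeight (μ i) (fun a => content ν ψ (toLex (i, a))) =
    if ∀ i, ∑ j ∈ Finset.univ.filter (fun j => β j = i), ν j = μ i then
      ∏ i, ((-1) ^ ((Finset.univ.filter fun j => β j = i).card + 1) *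
        (sourceWeight o ν (Finset.univ.filter fun j => β j = i) : ℤ))
    else 0 := by
  split_ifs with hμ
  · simp only [← sum_packed_mul_sum_firstClass (R := ℤ) ho]
    rw [← sum_prod_rowLabel hN hβ fun ψ => (-1) ^ (height ψ + 1) *
      ((∑ j ∈ firstClass ψ, ν j : ℕ) : ℤ)]
    refine Finset.sum_congr rfl fun ψ hψ => ?_
    obtain ⟨-, -, rfl⟩ := Finset.mem_filter.1 hψ
    simp only [← hμ, rowWeight_content hν, Finset.prod_ite_zero, Finset.mem_univ, true_imp_iff]
  · push Not at hμ
    obtain ⟨i, hi⟩ := hμ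
    refine Finset.sum_eq_zero fun ψ hψ => Finset.prod_eq_zero (Finset.mem_univ i) ?_
    obtain ⟨-, -, rfl⟩ := Finset.mem_filter.1 hψ
    exact rowWeight_content_eq_zero hi

open Classical in
theorem sum_prod_rowWeight (ho : WellFounded o) {ν : J → ℕ} (hν : ∀ j, 0 < ν j)
    (hN : Fintype.card J ≤ N + 1) (μ : ι → ℕ) :
    ∑ ψ : J → ι ×ₗ Fin (N + 1) with ∀ u v, o u v → ψ u < ψ v,
      ∏ i, rowWeight (μ i) (fun a => content ν ψ (toLex (i, a))) =
    ∑ β : J → ι with (∀ u v, o u v → β u ≤ β v) ∧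
        ∀ i, ∑ j ∈ Finset.univ.filter (fun j => β j = i), ν j = μ i,
      ∏ i, ((-1) ^ ((Finset.univ.filter fun j => β j = i).card + 1) *
        (sourceWeight o ν (Finset.univ.filter fun j => β j = i) : ℤ)) := by
  rw [← Finset.sum_fiberwise_of_maps_to (g := rowOf)
    (t := Finset.univ.filter fun β : J → ι => ∀ u v, o u v → β u ≤ β v),
    ← Finset.filter_filter (fun β : J → ι => ∀ u v, o u v → β u ≤ β v)]
  · refine (Finset.sum_congr rfl fun β hβ => ?_).trans (Finset.sum_filter _ _).symm
    rw [Finset.filter_filter, sum_prod_rowWeight_of_rowOf_eq ho hν hN μ (Finset.mem_filter.1 hβ).2]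
  · intro ψ hψ
    refine Finset.mem_filter.2 ⟨Finset.mem_univ _, fun u v huv => ?_⟩
    exact (Prod.Lex.lt_iff.1 ((Finset.mem_filter.1 hψ).2 u v huv)).elim le_of_lt fun h => h.1.le

end RowLabels

end Rows

section Functional

variable {R : Type*} [CommRing R]

theorem killCompl_psum {I : Type*} [Fintype I] (e : I ↪ ℕ) {k : ℕ} (hk : k ≠ 0) :
    killCompl e (psum R k : MvPowerSeries ℕ R) = ∑ x : I, monomial (single x k) 1 := by
  classical
  ext m
  rw [coeff_killCompl, map_sum]
  simp only [coeff_monomial]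
  change (if ∃ i, embDomain e m = single i k then (1 : R) else 0) = _
  split_ifs with h
  · obtain ⟨i, hi⟩ := h
    obtain ⟨x, rfl⟩ : i ∈ Set.range e := by
      by_contra hi'
      have := embDomain_of_notMem_range e m i hi'
      rw [hi, single_eq_same] at this
      exact hk this
    rw [← embDomain_single, embDomain_inj] at hi
    simp [hi, (single_left_injective hk).eq_iff]
  · refine (Finset.sum_eq_zero fun x _ => if_neg fun hx => h ⟨e x, ?_⟩).symm
    rw [hx, embDomain_single]

variable {J : Type*} [Fintype J]

open Classical in
theorem coeff_embDomain_prod_psum {I : Type*} [Fintype I] [DecidableEq I] (e : I ↪ ℕ) {ν : J → ℕ}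
    (hν : ∀ j, 0 < ν j) (m : I →₀ ℕ) :
    coeff (embDomain e m) ((∏ j, psum R (ν j) : SymFunc R) : MvPowerSeries ℕ R) =
      ∑ ψ : J → I with content ν ψ = m, 1 := by
  rw [← coeff_killCompl, ← Subalgebra.val_apply, map_prod, map_prod]
  simp only [Subalgebra.val_apply, killCompl_psum e (hν _).ne']
  rw [Finset.prod_univ_sum, Fintype.piFinset_univ, map_sum, Finset.sum_filter]
  refine Finset.sum_congr rfl fun ψ _ => ?_
  rw [prod_monomial, coeff_monomial, Finset.prod_const_one]
  simp only [content, eq_comm]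

theorem sum_fiber_eq_iff {ι : Type*} [DecidableEq ι] {β : J → ι} (hβ : β.Bijective) (μ : ι → ℕ)
    (ν : J → ℕ) :
    (∀ i, ∑ j ∈ Finset.univ.filter (fun j => β j = i), ν j = μ i) ↔ μ ∘ β = ν := by
  rw [hβ.surjective.forall, funext_iff]
  refine forall_congr' fun j => ?_
  have hfiber : (Finset.univ.filter fun i => β i = β j) = {j} := by
    ext i
    simp [hβ.injective.eq_iff]
  rw [hfiber, Finset.sum_singleton, Function.comp_apply, eq_comm]

variable {ι : Type*} [LinearOrder ι] [Fintype ι] {N : ℕ}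

open Classical in
/-- The pairing with `∏ i, p_{μ i}` in degree `n`, for the Hall inner product: it expands the
`p_{μ i}` in the `h_α` and pairs `h_α` with a series by taking its coefficient of `x ^ α`. Each
factor has a row of cells, and the cell `(i, a)` stands for the variable with index `e (i, a)`. -/
def rowFunctional (e : ι ×ₗ Fin (N + 1) ↪ ℕ) (n : ℕ) (μ : ι → ℕ) : MvPowerSeries ℕ R →ₗ[R] R :=
  ∑ m ∈ Finset.univ.finsuppAntidiag n,
    ((∏ i, rowWeight (μ i) (fun a => m (toLex (i, a))) : ℤ) : R) • coeff (embDomain e m)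

open Classical in
theorem rowFunctional_eq_sum (e : ι ×ₗ Fin (N + 1) ↪ ℕ) (μ : ι → ℕ) (ν : J → ℕ)
    (Ψ : Finset (J → ι ×ₗ Fin (N + 1))) (g : (J → ι ×ₗ Fin (N + 1)) → R) {f : MvPowerSeries ℕ R}
    (hf : ∀ m, coeff (embDomain e m) f = ∑ ψ ∈ Ψ with content ν ψ = m, g ψ) :
    rowFunctional e (∑ j, ν j) μ f =
      ∑ ψ ∈ Ψ, ((∏ i, rowWeight (μ i) (fun a => content ν ψ (toLex (i, a))) : ℤ) : R) * g ψ := by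
  have hmaps : ∀ ψ ∈ Ψ, content ν ψ ∈ Finset.univ.finsuppAntidiag (∑ j, ν j) := fun ψ _ => by
    rw [Finset.mem_finsuppAntidiag, ← degree_content ν ψ, degree_eq_sum]
    exact ⟨rfl, Finset.subset_univ _⟩
  rw [rowFunctional, LinearMap.sum_apply, ← Finset.sum_fiberwise_of_maps_to hmaps]
  refine Finset.sum_congr rfl fun m _ => ?_
  rw [LinearMap.smul_apply, hf, smul_eq_mul, Finset.mul_sum]
  exact Finset.sum_congr rfl fun ψ hψ => by rw [(Finset.mem_filter.1 hψ).2]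

theorem prod_sourceWeight_false (β : J → ι) (ν : J → ℕ) [Decidable β.Bijective] :
    ∏ i, ((-1) ^ ((Finset.univ.filter fun j => β j = i).card + 1) *
        (sourceWeight (fun _ _ => False) ν (Finset.univ.filter fun j => β j = i) : ℤ)) =
      if β.Bijective then
        ∏ i, ((∑ j ∈ Finset.univ.filter fun j => β j = i, ν j : ℕ) : ℤ) else 0 := by
  have hbij : β.Bijective ↔ ∀ i, (Finset.univ.filter fun j => β j = i).card = 1 := by
    refine (Function.bijective_iff_existsUnique β).trans (forall_congr' fun i => ?_)
    simp [Finset.card_eq_one, Finset.singleton_iff_unique_mem]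
  have hsources : ∀ U : Finset J, sources (fun _ _ => False) U = U := fun U => by simp [sources]
  simp only [sourceWeight, hsources, hbij]
  split_ifs with h
  · exact Finset.prod_congr rfl fun i _ => by simp [h i]
  · push Not at h
    obtain ⟨i, hi⟩ := h
    exact Finset.prod_eq_zero (Finset.mem_univ i) (by simp [hi])

open Classical in
theorem sum_prod_sourceWeight_false (μ : ι → ℕ) (ν : J → ℕ) :
    ∑ β : J → ι with ∀ i, ∑ j ∈ Finset.univ.filter (fun j => β j = i), ν j = μ i,
        ∏ i, ((-1) ^ ((Finset.univ.filter fun j => β j = i).card + 1) *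
          (sourceWeight (fun _ _ => False) ν (Finset.univ.filter fun j => β j = i) : ℤ)) =
      (Nat.card {σ : J ≃ ι // μ ∘ σ = ν} * ∏ i, μ i : ℕ) := by
  have hcard : (Finset.univ.filter fun β : J → ι =>
      (∀ i, ∑ j ∈ Finset.univ.filter (fun j => β j = i), ν j = μ i) ∧ β.Bijective).card =
      Nat.card {σ : J ≃ ι // μ ∘ σ = ν} := by
    rw [Nat.card_eq_fintype_card, Fintype.card_subtype]
    symm
    refine Finset.card_bij (fun σ _ => ⇑σ) ?_ (fun σ _ τ _ h => DFunLike.coe_injective h) ?_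
    · intro σ hσ
      rw [Finset.mem_filter, sum_fiber_eq_iff σ.bijective] at *
      exact ⟨Finset.mem_univ _, hσ.2, σ.bijective⟩
    · intro β hβ
      obtain ⟨-, hμ, hβ⟩ := Finset.mem_filter.1 hβ
      exact ⟨Equiv.ofBijective β hβ,
        Finset.mem_filter.2 ⟨Finset.mem_univ _, (sum_fiber_eq_iff hβ μ ν).1 hμ⟩, rfl⟩
  simp only [prod_sourceWeight_false]
  rw [← Finset.sum_filter, Finset.filter_filter, ← hcard, ← smul_eq_mul, ← Finset.sum_const,
    Nat.cast_sum]
  refine Finset.sum_congr rfl fun β hβ => ?_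
  simp only [(Finset.mem_filter.1 hβ).2.1, Nat.cast_prod]

theorem rowFunctional_prod_psum (e : ι ×ₗ Fin (N + 1) ↪ ℕ) (μ : ι → ℕ) {ν : J → ℕ}
    (hν : ∀ j, 0 < ν j) (hN : Fintype.card J ≤ N + 1) :
    rowFunctional e (∑ j, ν j) μ ((∏ j, psum R (ν j) : SymFunc R) : MvPowerSeries ℕ R) =
      (Nat.card {σ : J ≃ ι // μ ∘ σ = ν} * ∏ i, μ i : ℕ) := by
  classical
  have hwf : WellFounded fun _ _ : J => False := ⟨fun j => .intro j fun _ h => h.elim⟩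
  have hrows := sum_prod_rowWeight hwf hν hN μ
  simp only [false_imp_iff, implies_true, Finset.filter_true, true_and] at hrows
  rw [rowFunctional_eq_sum e μ ν Finset.univ _ (coeff_embDomain_prod_psum e hν)]
  simp only [mul_one]
  rw [← Int.cast_sum, hrows, sum_prod_sourceWeight_false, Int.cast_natCast]

end Functional

section Partition

variable {n : ℕ}

/-- The composition of `n` whose blocks are the parts of `μ` in weakly decreasing order. -/
def sortedComposition (μ : n.Partition) : Composition n where
  blocks := μ.parts.sort (· ≥ ·)
  blocks_pos h := μ.parts_pos ((Multiset.mem_sort _).1 h)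
  blocks_sum := by rw [← Multiset.sum_coe, Multiset.sort_eq, μ.parts_sum]

theorem map_blocksFun_sortedComposition (μ : n.Partition) :
    Finset.univ.val.map (sortedComposition μ).blocksFun = μ.parts := by
  rw [Fin.univ_val_map, Composition.ofFn_blocksFun]
  exact Multiset.sort_eq _ _

theorem psumPart_eq_prod (R : Type*) [CommRing R] (μ : n.Partition) :
    psumPart R μ = ∏ j, psum R ((sortedComposition μ).blocksFun j) := by
  rw [psumPart, ← map_blocksFun_sortedComposition, Multiset.map_map]
  rfl

theorem card_perm_mul_prod_blocksFun (μ : n.Partition) :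
    Nat.card {σ : Equiv.Perm (Fin (sortedComposition μ).length) //
      (sortedComposition μ).blocksFun ∘ σ = (sortedComposition μ).blocksFun} *
        ∏ i, (sortedComposition μ).blocksFun i = zPart μ := by
  classical
  set c := sortedComposition μ
  have hprod : ∏ i, c.blocksFun i = ∏ k ∈ μ.parts.toFinset, k ^ μ.parts.count k := by
    rw [← Finset.prod_multiset_count, ← map_blocksFun_sortedComposition]
    rfl
  have himage : Finset.univ.image c.blocksFun = μ.parts.toFinset := by
    rw [← map_blocksFun_sortedComposition]
    rfl
  rw [zPart, Finset.prod_mul_distrib, ← hprod, Nat.card_eq_fintype_card,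
    DomMulAct.stabilizer_card' c.blocksFun, himage]
  congr 1
  refine Finset.prod_congr rfl fun k _ => congrArg Nat.factorial ?_
  rw [Fintype.card_subtype, ← map_blocksFun_sortedComposition, Multiset.count_map]
  simp only [eq_comm (a := k)]
  rfl

theorem rowFunctional_psumPart {R : Type*} [CommRing R] (μ ρ : n.Partition)
    (e : Fin (sortedComposition μ).length ×ₗ Fin (n + 1) ↪ ℕ) :
    rowFunctional e n (sortedComposition μ).blocksFun (psumPart R ρ : MvPowerSeries ℕ R) =
      if ρ = μ then (zPart μ : R) else 0 := by
  have hlength : Fintype.card (Fin (sortedComposition ρ).length) ≤ n + 1 := by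
    rw [Fintype.card_fin]
    exact (sortedComposition ρ).length_le.trans n.le_succ
  have hprod := rowFunctional_prod_psum (R := R) e (sortedComposition μ).blocksFun
    (ν := (sortedComposition ρ).blocksFun) (sortedComposition ρ).one_le_blocksFun hlength
  rw [(sortedComposition ρ).sum_blocksFun] at hprod
  rw [psumPart_eq_prod, hprod]
  split_ifs with hρ
  · subst hρ
    rw [card_perm_mul_prod_blocksFun]
  · have : IsEmpty {σ : Fin (sortedComposition ρ).length ≃ Fin (sortedComposition μ).length //
        (sortedComposition μ).blocksFun ∘ σ = (sortedComposition ρ).blocksFun} := by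
      refine ⟨fun ⟨σ, hσ⟩ => hρ (Nat.Partition.ext ?_)⟩
      rw [← map_blocksFun_sortedComposition, ← map_blocksFun_sortedComposition μ, ← hσ,
        ← Finset.univ_map_equiv_to_embedding σ, Finset.map_val, Multiset.map_map]
      rfl
    rw [Nat.card_of_isEmpty, zero_mul, Nat.cast_zero]

end Partition

section Orientation

variable {V : Type*}

/-- The orientation of `G` along which `f` increases. -/
def orientation {α : Type*} [LT α] (G : SimpleGraph V) (f : V → α) (u v : V) : Prop :=
  G.Adj u v ∧ f u < f v

/-- An acyclic orientation of `G`, given by its relation `o`; acyclicity is stated as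
well-foundedness, which is equivalent to it on a finite vertex set. -/
structure IsAcyclicOrientation (G : SimpleGraph V) (o : V → V → Prop) : Prop where
  adj {u v : V} : o u v → G.Adj u v
  total {u v : V} : G.Adj u v → o u v ∨ o v u
  wf : WellFounded o

theorem isAcyclicOrientation_orientation [Finite V] {α : Type*} [LinearOrder α]
    {G : SimpleGraph V} {f : V → α} (hf : ∀ u v, G.Adj u v → f u ≠ f v) :
    IsAcyclicOrientation G (orientation G f) where
  adj h := h.1
  total {u v} huv := (hf u v huv).lt_or_gt.imp (⟨huv, ·⟩) (⟨huv.symm, ·⟩)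
  wf :=
    have : IsStrictOrder V (InvImage (· < ·) f) := {
      irrefl := fun _ => lt_irrefl _
      trans := fun _ _ _ => lt_trans }
    Subrelation.wf (fun h => h.2)
      (Finite.wellFounded_of_trans_of_irrefl (InvImage (· < ·) f))

theorem IsAcyclicOrientation.orientation_eq_iff {α : Type*} [Preorder α] {G : SimpleGraph V}
    {o : V → V → Prop} (ho : IsAcyclicOrientation G o) (f : V → α) :
    ((∀ u v, G.Adj u v → f u ≠ f v) ∧ orientation G f = o) ↔ ∀ u v, o u v → f u < f v := by
  constructor
  · rintro ⟨-, rfl⟩ u v huv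
    exact huv.2
  · intro h
    refine ⟨fun u v huv => ?_, ?_⟩
    · exact (ho.total huv).elim (fun h' => (h u v h').ne) fun h' => (h v u h').ne'
    · ext u v
      exact ⟨fun ⟨huv, hlt⟩ => (ho.total huv).resolve_right fun h' => (h v u h').asymm hlt,
        fun huv => ⟨ho.adj huv, h u v huv⟩⟩

variable [Fintype V]

open Classical in
/-- The acyclic orientations of `G`. -/
def acyclicOrientations (G : SimpleGraph V) : Finset (V → V → Prop) :=
  Finset.univ.filter (IsAcyclicOrientation G)

@[simp] theorem mem_acyclicOrientations {G : SimpleGraph V} {o : V → V → Prop} :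
    o ∈ acyclicOrientations G ↔ IsAcyclicOrientation G o := by
  simp [acyclicOrientations]

open Classical in
/-- The number of edges `(u, v)` of `D` that `o` orients from `v` to `u`. -/
def orientationInv (D : Digraph V) (o : V → V → Prop) : ℕ :=
  (Finset.univ.filter fun e : V × V => D.Adj e.1 e.2 ∧ o e.2 e.1).card

theorem orientationInv_orientation {α : Type*} [Preorder α] (D : Digraph V) (f : V → α) :
    orientationInv D (orientation D.toSimpleGraphInclusive f) =
      Nat.card {e : V × V // D.Adj e.1 e.2 ∧ f e.2 < f e.1} := by
  classical
  rw [Nat.card_eq_fintype_card, Fintype.card_subtype, orientationInv]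
  refine congrArg Finset.card (Finset.filter_congr fun e _ => and_congr_right fun he => ?_)
  refine ⟨fun h => h.2, fun h => ⟨⟨fun heq => ?_, Or.inr he⟩, h⟩⟩
  exact lt_irrefl _ (heq ▸ h)

end Orientation

section BlockMaps

variable {V : Type*} [Fintype V] {ι : Type*} [LinearOrder ι] [Fintype ι]

open Classical in
/-- The maps that weakly increase along `o` and whose fibers have the sizes `μ i` and exactly one
`o`-source each. -/
def blockMaps (o : V → V → Prop) (μ : ι → ℕ) : Finset (V → ι) :=
  Finset.univ.filter fun β => (∀ u v, o u v → β u ≤ β v) ∧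
    ∀ i, (Finset.univ.filter fun v => β v = i).card = μ i ∧
      (sources o (Finset.univ.filter fun v => β v = i)).card = 1

theorem mem_blockMaps {o : V → V → Prop} {μ : ι → ℕ} {β : V → ι} :
    β ∈ blockMaps o μ ↔ (∀ u v, o u v → β u ≤ β v) ∧
      ∀ i, (Finset.univ.filter fun v => β v = i).card = μ i ∧
        (sources o (Finset.univ.filter fun v => β v = i)).card = 1 := by
  simp [blockMaps]

open Classical in
theorem sum_prod_rowWeight_one {N : ℕ} {o : V → V → Prop} (ho : WellFounded o)
    (hN : Fintype.card V ≤ N + 1) (μ : ι → ℕ) :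
    ∑ ψ : V → ι ×ₗ Fin (N + 1) with ∀ u v, o u v → ψ u < ψ v,
      ∏ i, rowWeight (μ i) (fun a => content (fun _ => 1) ψ (toLex (i, a))) =
    (-1) ^ (∑ i, (μ i + 1)) * ((blockMaps o μ).card : ℤ) := by
  rw [sum_prod_rowWeight ho (fun _ => one_pos) hN]
  simp only [sourceWeight, Finset.sum_const, smul_eq_mul, mul_one]
  rw [mul_comm, ← nsmul_eq_mul, ← Finset.sum_const, blockMaps]
  simp only [forall_and, ← and_assoc]
  rw [← Finset.filter_filter _ fun β : V → ι =>
    ∀ i, (sources o (Finset.univ.filter fun v => β v = i)).card = 1,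
    Finset.sum_filter (fun β : V → ι =>
      ∀ i, (sources o (Finset.univ.filter fun v => β v = i)).card = 1)]
  refine Finset.sum_congr rfl fun β hβ => ?_
  have hμ := (Finset.mem_filter.1 hβ).2.2
  have hterm : ∀ i, (-1 : ℤ) ^ ((Finset.univ.filter fun v => β v = i).card + 1) *
      ((if (sources o (Finset.univ.filter fun v => β v = i)).card = 1 then
        (sources o (Finset.univ.filter fun v => β v = i)).card else 0 : ℕ) : ℤ) =
      if (sources o (Finset.univ.filter fun v => β v = i)).card = 1 then
        (-1) ^ (μ i + 1) else 0 := fun i => by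
    rw [hμ i]
    split_ifs with h <;> simp [h]
  simp only [hterm, Finset.prod_ite_zero, Finset.mem_univ, true_imp_iff,
    Finset.prod_pow_eq_pow_sum]

end BlockMaps

section Chromatic

variable {V : Type*} [Fintype V]

open Classical in
theorem coeff_embDomain_chromaticQSym {I : Type*} [Fintype I] [DecidableEq I] (D : Digraph V)
    (e : I ↪ ℕ) (m : I →₀ ℕ) :
    coeff (embDomain e m) (chromaticQSym D) =
      ∑ ψ ∈ Finset.univ.filter (fun ψ : V → I => IsProper D (e ∘ ψ)) with
        content (fun _ => 1) ψ = m, Polynomial.X ^ asc D (e ∘ ψ) := by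
  have hcontent : ∀ ψ : V → I,
      colorExponent (e ∘ ψ) = embDomain e (content (fun _ => 1) ψ) := fun ψ => by
    simp only [embDomain_eq_mapDomain, content, mapDomain_finsetSum, colorExponent,
      mapDomain_single, Function.comp_apply]
  change ∑ κ ∈ _, _ = _
  refine (Finset.sum_bij (fun ψ _ => e ∘ ψ) ?_ ?_ ?_ fun _ _ => rfl).symm
  · intro ψ hψ
    simp only [Finset.mem_filter, Finset.mem_univ, true_and] at hψ
    rw [Finset.mem_filter, hcontent, hψ.2, Fintype.mem_piFinset]
    refine ⟨fun v => ?_, hψ.1, rfl⟩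
    rw [mem_support_iff, Function.comp_apply, embDomain_apply_self, ← hψ.2,
      content_apply_ne_zero fun _ => one_pos]
    exact ⟨v, rfl⟩
  · exact fun ψ _ ψ' _ h => e.injective.comp_left h
  · intro κ hκ
    rw [Finset.mem_filter, Fintype.mem_piFinset] at hκ
    obtain ⟨hsupp, hproper, hexp⟩ := hκ
    have hrange : ∀ v, κ v ∈ Set.range e := fun v => by
      by_contra hv
      exact mem_support_iff.1 (hsupp v) (embDomain_of_notMem_range _ _ _ hv)
    choose ψ hψ using hrange
    obtain rfl : e ∘ ψ = κ := funext hψ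
    rw [hcontent, embDomain_inj] at hexp
    exact ⟨ψ, by simpa using ⟨hproper, hexp⟩, rfl⟩

theorem asc_comp_of_strictAnti {I : Type*} [LinearOrder I] (D : Digraph V) {e : I → ℕ}
    (he : StrictAnti e) (ψ : V → I) :
    asc D (e ∘ ψ) = orientationInv D (orientation D.toSimpleGraphInclusive ψ) := by
  classical
  rw [orientationInv_orientation, Nat.card_eq_fintype_card, Fintype.card_subtype, asc]
  simp only [Function.comp_apply, he.lt_iff_gt]

theorem rowFunctional_chromaticQSym {ι : Type*} [LinearOrder ι] [Fintype ι] {N : ℕ}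
    (D : Digraph V) (hN : Fintype.card V ≤ N + 1) {e : ι ×ₗ Fin (N + 1) ↪ ℕ}
    (he : StrictAnti e) (μ : ι → ℕ) :
    rowFunctional e (Fintype.card V) μ (chromaticQSym D) =
      (-1) ^ (∑ i, (μ i + 1)) * ∑ o ∈ acyclicOrientations D.toSimpleGraphInclusive,
        (blockMaps o μ).card * Polynomial.X ^ orientationInv D o := by
  classical
  set G := D.toSimpleGraphInclusive with hG
  have hproper : ∀ ψ : V → ι ×ₗ Fin (N + 1),
      IsProper D (e ∘ ψ) ↔ ∀ u v, G.Adj u v → ψ u ≠ ψ v := fun ψ => by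
    simp [IsProper, hG]
  have hcolorings := rowFunctional_eq_sum e μ (fun _ => 1) _ _ (coeff_embDomain_chromaticQSym D e)
  rw [Finset.sum_const, smul_eq_mul, mul_one, Finset.card_univ] at hcolorings
  rw [hcolorings, Finset.mul_sum, ← Finset.sum_fiberwise_of_maps_to (g := orientation G)
    (t := acyclicOrientations G)]
  · refine Finset.sum_congr rfl fun o ho => ?_
    rw [mem_acyclicOrientations] at ho
    simp only [Finset.filter_filter, hproper, ho.orientation_eq_iff]
    rw [← mul_assoc, ← Int.cast_natCast (R := Polynomial ℚ) (blockMaps o μ).card, ← Int.cast_one,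
      ← Int.cast_neg, ← Int.cast_pow, ← Int.cast_mul, ← sum_prod_rowWeight_one ho.wf hN,
      Int.cast_sum, Finset.sum_mul]
    refine Finset.sum_congr rfl fun ψ hψ => ?_
    rw [asc_comp_of_strictAnti D he,
      ((ho.orientation_eq_iff ψ).2 (Finset.mem_filter.1 hψ).2).2]
  · intro ψ hψ
    rw [Finset.mem_filter, hproper] at hψ
    exact mem_acyclicOrientations.2 (isAcyclicOrientation_orientation hψ.2)

end Chromatic

section Rank

variable {V : Type*}

/-- The length of the longest directed path of `o` that ends in `x`. -/
def orientationRank (o : V → V → Prop) (x : V) : ℕ :=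
  sSup {k | ∃ p : List V, p.length = k ∧ p.IsChain o ∧ p.getLast? = some x}

theorem length_le_card_of_isChain [Fintype V] {o : V → V → Prop} (ho : WellFounded o)
    {p : List V} (hp : p.IsChain o) : p.length ≤ Fintype.card V := by
  have hwf : WellFounded (Relation.TransGen o) := ho.transGen
  have hpair : p.Pairwise (Relation.TransGen o) :=
    List.isChain_iff_pairwise.1 (hp.imp fun _ _ => Relation.TransGen.single)
  refine List.Nodup.length_le_card (hpair.imp ?_)
  rintro u _ h rfl
  exact hwf.irrefl.irrefl u h

theorem bddAbove_length_of_isChain [Finite V] {o : V → V → Prop} (ho : WellFounded o) (x : V) :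
    BddAbove {k | ∃ p : List V, p.length = k ∧ p.IsChain o ∧ p.getLast? = some x} := by
  cases nonempty_fintype V
  refine ⟨Fintype.card V, ?_⟩
  rintro k ⟨p, rfl, hp, -⟩
  exact length_le_card_of_isChain ho hp

theorem orientationRank_lt [Finite V] {o : V → V → Prop} (ho : WellFounded o) {u v : V}
    (huv : o u v) : orientationRank o u < orientationRank o v := by
  obtain ⟨p, hlength, hp, hlast⟩ := Nat.sSup_mem (s := {k | ∃ p : List V, p.length = k ∧
    p.IsChain o ∧ p.getLast? = some u}) ⟨1, [u], rfl, List.isChain_singleton _, rfl⟩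
    (bddAbove_length_of_isChain ho u)
  refine Nat.lt_of_succ_le (le_csSup (bddAbove_length_of_isChain ho v) ⟨p ++ [v], ?_, ?_, ?_⟩)
  · rw [List.length_append, hlength]
    rfl
  · exact hp.append (List.isChain_singleton _) (by simp [hlast, huv])
  · exact List.getLast?_concat

theorem graphRank_eq {n : ℕ} (G : SimpleGraph (Fin n)) (σ : Equiv.Perm (Fin n)) (x : Fin n) :
    graphRank G σ x = orientationRank (orientation G σ.symm) x := by
  rw [graphRank, orientationRank]
  congr 1
  ext k
  constructor
  · rintro ⟨p, hlength, hp, hlast⟩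
    refine ⟨p.map σ, by simpa using hlength, ?_, by simp [hlast]⟩
    exact (List.isChain_map σ).2 (hp.imp fun i j h => ⟨h.2, by simpa using h.1⟩)
  · rintro ⟨p, hlength, hp, hlast⟩
    refine ⟨p.map σ.symm, by simpa using hlength, ?_, by simp [hlast]⟩
    exact (List.isChain_map σ.symm).2 (hp.imp fun i j h => ⟨h.2, by simpa using h.1⟩)

end Rank

section Sorting

variable {V ι : Type*}

/-- The key by which the letters are sorted: block, rank, label. -/
def sortKey (o : V → V → Prop) (β : V → ι) (v : V) : ι ×ₗ (ℕ ×ₗ V) :=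
  toLex (β v, toLex (orientationRank o v, v))

theorem sortKey_injective (o : V → V → Prop) (β : V → ι) : Function.Injective (sortKey o β) :=
  fun _ _ h => congrArg (fun k => (ofLex (ofLex k).2).2) h

theorem sortKey_lt_iff [LT V] [LT ι] {o : V → V → Prop} {β : V → ι} {u v : V} :
    sortKey o β u < sortKey o β v ↔ β u < β v ∨ β u = β v ∧
      (orientationRank o u < orientationRank o v ∨
        orientationRank o u = orientationRank o v ∧ u < v) := by
  rw [sortKey, sortKey, Prod.Lex.toLex_lt_toLex, Prod.Lex.toLex_lt_toLex]

theorem sortKey_lt_of_rel [Finite V] [LT V] [PartialOrder ι] {o : V → V → Prop}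
    (ho : WellFounded o) {β : V → ι} {u v : V} (huv : o u v) (hβ : β u ≤ β v) :
    sortKey o β u < sortKey o β v :=
  sortKey_lt_iff.2 (hβ.lt_or_eq.imp_right fun h => ⟨h, Or.inl (orientationRank_lt ho huv)⟩)

theorem eq_of_monotone_of_card_fiber_eq {n : ℕ} [LinearOrder ι] [Finite ι] {a b : Fin n → ι}
    (ha : Monotone a) (hb : Monotone b)
    (h : ∀ i, (Finset.univ.filter fun x => a x = i).card =
      (Finset.univ.filter fun x => b x = i).card) : a = b := by
  cases nonempty_fintype ι
  have hcard : ∀ (f : Fin n → ι) (i : ι), (Finset.univ.filter fun x => f x ≤ i).card =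
      ∑ j with j ≤ i, (Finset.univ.filter fun x => f x = j).card := fun f i => by
    rw [Finset.card_eq_sum_card_fiberwise (f := f) (t := Finset.univ.filter fun j => j ≤ i)
      (fun x hx => by simpa using hx)]
    refine Finset.sum_congr rfl fun j hj => congrArg _ ?_
    rw [Finset.filter_filter]
    exact Finset.filter_congr fun x _ =>
      and_iff_right_of_imp fun hx => hx ▸ (Finset.mem_filter.1 hj).2
  funext j
  refine eq_of_forall_ge_iff fun i => ?_
  rw [← Tuple.lt_card_le_iff_apply_le_of_monotone ha,
    ← Tuple.lt_card_le_iff_apply_le_of_monotone hb, hcard, hcard]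
  simp only [h]

end Sorting

section Blocks

variable {n : ℕ} (c : Composition n) (G : SimpleGraph (Fin n)) (σ : Equiv.Perm (Fin n))

theorem index_eq_iff {c : Composition n} {j : Fin n} {i : Fin c.length} :
    c.index j = i ↔ c.sizeUpTo i ≤ j ∧ (j : ℕ) < c.sizeUpTo (i + 1) := by
  rw [eq_comm, ← c.mem_range_embedding_iff', c.mem_range_embedding_iff]

theorem monotone_index : Monotone c.index := fun j k hjk => by
  by_contra! h
  exact hjk.not_gt <| (c.lt_sizeUpTo_index_succ k).trans_le <|
    (c.monotone_sizeUpTo (Nat.succ_le_of_lt h)).trans (c.sizeUpTo_index_le j)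

theorem card_index_fiber (i : Fin c.length) :
    (Finset.univ.filter fun j => c.index j = i).card = c.blocksFun i := by
  have hrange : (Finset.univ.filter fun j => c.index j = i) =
      Finset.univ.map (c.embedding i).toEmbedding := by
    ext j
    simpa [eq_comm] using (c.mem_range_embedding_iff' (j := j) (i := i)).symm
  rw [hrange, Finset.card_map, Finset.card_fin]

/-- The index of the segment that contains the letter `v` when the word `σ` is cut into contiguous
segments whose lengths are the blocks of `c`. -/
def segmentIndex (v : Fin n) : Fin c.length :=
  c.index (σ.symm v)

@[simp] theorem segmentIndex_apply (j : Fin n) : segmentIndex c σ (σ j) = c.index j := by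
  rw [segmentIndex, σ.symm_apply_apply]

theorem card_segmentIndex_fiber (i : Fin c.length) :
    (Finset.univ.filter fun v => segmentIndex c σ v = i).card = c.blocksFun i := by
  rw [← card_index_fiber]
  refine Finset.card_equiv σ.symm fun v => ?_
  rw [Finset.mem_filter_univ, Finset.mem_filter_univ, segmentIndex]

theorem mem_sources_segment {j : Fin n} {i : Fin c.length} :
    σ j ∈ sources (orientation G σ.symm) (Finset.univ.filter fun v => segmentIndex c σ v = i) ↔
      c.index j = i ∧ ∀ k : Fin n, c.sizeUpTo i ≤ k → k < j → ¬ G.Adj (σ k) (σ j) := by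
  rw [mem_sources, σ.surjective.forall]
  simp only [Finset.mem_filter, Finset.mem_univ, true_and, segmentIndex_apply, orientation,
    Equiv.symm_apply_apply, not_and]
  refine and_congr_right fun hj => forall_congr' fun k => ?_
  refine ⟨fun h hk hkj hadj => h (index_eq_iff.2 ⟨hk, ?_⟩) hadj hkj,
    fun h hk hadj hkj => h (index_eq_iff.1 hk).1 hkj hadj⟩
  exact (Fin.lt_def.1 hkj).trans (index_eq_iff.1 hj).2

theorem card_sources_segment_eq_one_iff (i : Fin c.length) :
    (sources (orientation G σ.symm)
        (Finset.univ.filter fun v => segmentIndex c σ v = i)).card = 1 ↔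
      ∀ j : Fin n, c.index j = i → ¬ IsGIsolated G σ (c.sizeUpTo i) j := by
  have hlt := c.sizeUpTo_strict_mono i.2
  let first : Fin n := ⟨c.sizeUpTo i, hlt.trans_le (c.sizeUpTo_le (i + 1))⟩
  have hfirst : σ first ∈ sources (orientation G σ.symm)
      (Finset.univ.filter fun v => segmentIndex c σ v = i) :=
    (mem_sources_segment c G σ).2 ⟨index_eq_iff.2 ⟨le_rfl, hlt⟩,
      fun k hk hkfirst => absurd hk (not_le.2 hkfirst)⟩
  constructor
  · rintro h j hj ⟨hfirst_lt, hadj⟩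
    have heq := Finset.card_le_one.1 h.le _ ((mem_sources_segment c G σ).2 ⟨hj, hadj⟩) _ hfirst
    rw [σ.injective heq] at hfirst_lt
    exact lt_irrefl _ hfirst_lt
  · refine fun h => Finset.card_eq_one.2
      ⟨σ first, Finset.eq_singleton_iff_unique_mem.2 ⟨hfirst, fun v hv => ?_⟩⟩
    obtain ⟨j, rfl⟩ := σ.surjective v
    obtain ⟨hj, hadj⟩ := (mem_sources_segment c G σ).1 hv
    have hle : (j : ℕ) ≤ c.sizeUpTo i := not_lt.1 fun hlt => h j hj ⟨hlt, hadj⟩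
    exact congrArg σ (Fin.ext (hle.antisymm (index_eq_iff.1 hj).1))

theorem not_isGDescent_iff {j k : Fin n} (hjk : (k : ℕ) = j + 1) (h : c.index j = c.index k) :
    ¬ IsGDescent G σ j ↔ sortKey (orientation G σ.symm) (segmentIndex c σ) (σ j) <
      sortKey (orientation G σ.symm) (segmentIndex c σ) (σ k) := by
  have hne : σ j ≠ σ k := σ.injective.ne fun heq => by simp [heq] at hjk
  have hdescent : IsGDescent G σ j ↔
      sortKey (orientation G σ.symm) (segmentIndex c σ) (σ k) <
        sortKey (orientation G σ.symm) (segmentIndex c σ) (σ j) := by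
    rw [sortKey_lt_iff, segmentIndex_apply, segmentIndex_apply, h, IsGDescent]
    simp only [← hjk, ← Fin.ext_iff, exists_eq_left, graphRank_eq, lt_irrefl, false_or, true_and]
    simp only [eq_comm]
  rw [hdescent, not_lt, le_iff_lt_or_eq]
  exact or_iff_left ((sortKey_injective _ _).ne hne)

theorem strictMono_sortKey_iff :
    StrictMono (sortKey (orientation G σ.symm) (segmentIndex c σ) ∘ σ) ↔
      ∀ j k : Fin n, (k : ℕ) = j + 1 → c.index j = c.index k → ¬ IsGDescent G σ j := by
  constructor
  · exact fun h j k hjk heq => (not_isGDescent_iff c G σ hjk heq).2 (h (Fin.lt_def.2 (by omega)))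
  · intro h
    have hnext : ∀ j k : Fin n, (k : ℕ) = j + 1 →
        sortKey (orientation G σ.symm) (segmentIndex c σ) (σ j) <
          sortKey (orientation G σ.symm) (segmentIndex c σ) (σ k) := fun j k hjk => by
      rcases (monotone_index c (Fin.le_def.2 (by omega : (j : ℕ) ≤ k))).lt_or_eq with hlt | heq
      · exact sortKey_lt_iff.2 (Or.inl (by simpa using hlt))
      · exact (not_isGDescent_iff c G σ hjk heq).1 (h j k hjk heq)
    cases n with
    | zero => exact fun j => j.elim0
    | succ n => exact Fin.strictMono_iff_lt_succ.2 fun j => hnext _ _ (by simp)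

theorem mem_NSet_iff (μ : n.Partition) (G : SimpleGraph (Fin n)) (σ : Equiv.Perm (Fin n)) :
    σ ∈ NSet μ G ↔
      (∀ i, (sources (orientation G σ.symm) (Finset.univ.filter
          fun v => segmentIndex (sortedComposition μ) σ v = i)).card = 1) ∧
        StrictMono (sortKey (orientation G σ.symm) (segmentIndex (sortedComposition μ) σ) ∘ σ) := by
  set c := sortedComposition μ
  have hlength : μ.parts.card = c.length := (Multiset.length_sort _).symm
  have hsum : ∀ i, partialSum μ i = c.sizeUpTo i := fun _ => rfl
  simp only [NSet, Finset.mem_filter, Finset.mem_univ, true_and, hlength, hsum,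
    card_sources_segment_eq_one_iff, strictMono_sortKey_iff]
  constructor
  · refine fun h => ⟨fun i j hj => (h i i.2).1 j (index_eq_iff.1 hj).1 (index_eq_iff.1 hj).2,
      fun j k hjk heq => ?_⟩
    obtain ⟨hle, -⟩ := index_eq_iff.1 heq
    exact (h (c.index k) (c.index k).2).2 j hle (hjk ▸ c.lt_sizeUpTo_index_succ k)
  · refine fun ⟨hisolated, hdescent⟩ i hi =>
      ⟨fun j hle hlt => hisolated ⟨i, hi⟩ j (index_eq_iff.2 ⟨hle, hlt⟩), fun j hle hlt => ?_⟩
    have hk : (j : ℕ) + 1 < n := hlt.trans_le (c.sizeUpTo_le _)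
    refine hdescent j ⟨j + 1, hk⟩ rfl (Eq.trans (b := ⟨i, hi⟩) ?_ (Eq.symm ?_)) <;>
      refine index_eq_iff.2 ⟨?_, ?_⟩ <;> dsimp only <;> omega

theorem exists_perm_of_mem_blockMaps {o : Fin n → Fin n → Prop} (ho : IsAcyclicOrientation G o)
    {β : Fin n → Fin c.length} (hβ : β ∈ blockMaps o c.blocksFun) :
    ∃ σ : Equiv.Perm (Fin n), orientation G σ.symm = o ∧ segmentIndex c σ = β ∧
      StrictMono (sortKey o β ∘ σ) := by
  obtain ⟨hmono, hfiber⟩ := mem_blockMaps.1 hβ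
  let σ := Tuple.sort (sortKey o β)
  have hσ : StrictMono (sortKey o β ∘ σ) :=
    (Tuple.monotone_sort (sortKey o β)).strictMono_of_injective
      ((sortKey_injective o β).comp σ.injective)
  refine ⟨σ, ((ho.orientation_eq_iff σ.symm).2 fun u v huv => ?_).2, ?_, hσ⟩
  · rw [← hσ.lt_iff_lt]
    simpa using sortKey_lt_of_rel ho.wf huv (hmono u v huv)
  · have hβσ : Monotone (β ∘ σ) := monotone_iff_forall_lt.2 fun j k hjk =>
      (sortKey_lt_iff.1 (hσ hjk)).elim le_of_lt fun h => h.1.le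
    have hindex : c.index = β ∘ σ :=
      eq_of_monotone_of_card_fiber_eq (monotone_index c) hβσ fun i => by
        rw [card_index_fiber, ← (hfiber i).1]
        exact Finset.card_equiv σ.symm fun v => by simp
    ext v
    simp [segmentIndex, hindex]

theorem sum_NSet (D : Digraph (Fin n)) (μ : n.Partition) :
    ∑ σ ∈ NSet μ D.toSimpleGraphInclusive, (Polynomial.X : Polynomial ℚ) ^ digraphInv D σ =
      ∑ o ∈ acyclicOrientations D.toSimpleGraphInclusive,
        (blockMaps o (sortedComposition μ).blocksFun).card *
          Polynomial.X ^ orientationInv D o := by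
  classical
  set c := sortedComposition μ with hc
  set G := D.toSimpleGraphInclusive
  simp only [← nsmul_eq_mul, ← Finset.sum_const]
  rw [Finset.sum_sigma']
  refine Finset.sum_bij (fun σ _ => ⟨orientation G σ.symm, segmentIndex c σ⟩) ?_ ?_ ?_ ?_
  · intro σ hσ
    rw [Finset.mem_sigma, mem_acyclicOrientations, mem_blockMaps]
    exact ⟨isAcyclicOrientation_orientation fun u v huv => σ.symm.injective.ne huv.ne,
      fun u v huv => monotone_index c huv.2.le,
      fun i => ⟨card_segmentIndex_fiber c σ i, ((mem_NSet_iff μ G σ).1 hσ).1 i⟩⟩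
  · intro σ hσ τ hτ h
    obtain ⟨horientation, hsegment⟩ := Sigma.mk.inj h
    have hσmono := ((mem_NSet_iff μ G σ).1 hσ).2
    rw [← hc, horientation, eq_of_heq hsegment] at hσmono
    have hcomp := (hσmono.range_inj ((mem_NSet_iff μ G τ).1 hτ).2).1 (by
      rw [Set.range_comp _ σ, Set.range_comp _ τ, σ.range_eq_univ, τ.range_eq_univ])
    exact Equiv.ext fun j => sortKey_injective _ _ (congrFun hcomp j)
  · rintro ⟨o, β⟩ h
    obtain ⟨ho, hβ⟩ := Finset.mem_sigma.1 h
    obtain ⟨σ, rfl, rfl, hσ⟩ :=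
      exists_perm_of_mem_blockMaps c G (mem_acyclicOrientations.1 ho) hβ
    exact ⟨σ, (mem_NSet_iff μ G σ).2 ⟨fun i => ((mem_blockMaps.1 hβ).2 i).2, hσ⟩, rfl⟩
  · intro σ _
    rw [orientationInv_orientation, Nat.card_eq_fintype_card, Fintype.card_subtype, digraphInv]

end Blocks

section Newton

variable {R : Type*} [CommRing R]

theorem eq_of_forall_restr_eq {f g : SymFunc R} (h : ∀ N, restr N f = restr N g) : f = g := by
  obtain ⟨a, ha⟩ := f.2.1
  obtain ⟨b, hb⟩ := g.2.1
  exact eq_of_restr_eq (d := max a b) (fun m hm => ha m ((le_max_left a b).trans_lt hm))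
    (fun m hm => hb m ((le_max_right a b).trans_lt hm)) fun m _ => by rw [h]

theorem restr_psum (N : ℕ) {k : ℕ} (hk : k ≠ 0) :
    restr N (psum R k) = (MvPolynomial.psum (Fin N) R k : MvPowerSeries (Fin N) R) := by
  rw [restr, AlgHom.comp_apply, Subalgebra.val_apply, killCompl_psum _ hk, MvPolynomial.psum,
    ← MvPolynomial.coeToMvPowerSeries.ringHom_apply, map_sum]
  simp [MvPolynomial.X_pow_eq_monomial, MvPolynomial.coe_monomial]

theorem succ_mul_mvPolynomial_esymm (σ : Type*) [Fintype σ] (k : ℕ) :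
    ((k + 1 : ℕ) : MvPolynomial σ R) * MvPolynomial.esymm σ R (k + 1) =
      ∑ p ∈ Finset.HasAntidiagonal.antidiagonal k,
        (-1) ^ p.1 * MvPolynomial.psum σ R (p.1 + 1) * MvPolynomial.esymm σ R p.2 := by
  rw [MvPolynomial.mul_esymm_eq_sum, Finset.sum_filter, Finset.Nat.sum_antidiagonal_succ',
    if_neg (lt_irrefl _), zero_add, ← Finset.Nat.sum_antidiagonal_swap, Finset.mul_sum]
  refine Finset.sum_congr rfl fun p hp => ?_
  rw [Finset.HasAntidiagonal.mem_antidiagonal] at hp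
  have hsign := neg_one_pow_mul_self (A := MvPolynomial σ R) p.2
  rw [Prod.fst_swap, Prod.snd_swap, if_pos (by omega), ← hp, add_assoc, pow_add, pow_add]
  linear_combination (-1) ^ p.1 * MvPolynomial.psum σ R (p.1 + 1) *
    MvPolynomial.esymm σ R p.2 * hsign

theorem succ_mul_esymm (k : ℕ) :
    ((k + 1 : ℕ) : SymFunc R) * esymm R (k + 1) =
      ∑ p ∈ Finset.HasAntidiagonal.antidiagonal k, (-1) ^ p.1 * psum R (p.1 + 1) * esymm R p.2 := by
  refine eq_of_forall_restr_eq fun N => ?_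
  have hN := congrArg (MvPolynomial.coeToMvPowerSeries.ringHom (R := R))
    (succ_mul_mvPolynomial_esymm (Fin N) k)
  simp only [map_sum, map_mul, map_pow, map_neg, map_one, map_natCast,
    MvPolynomial.coeToMvPowerSeries.ringHom_apply] at hN
  simpa only [map_sum, map_mul, map_pow, map_neg, map_one, map_natCast, restr_esymm,
    restr_psum _ (Nat.succ_ne_zero _)] using hN

variable (R) in
/-- The generating function of the elementary symmetric functions. -/
def esymmSeries : PowerSeries (SymFunc R) := PowerSeries.mk (esymm R)

variable (R) in
/-- The generating function of the complete homogeneous symmetric functions. -/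
def hsymmSeries : PowerSeries (SymFunc R) := PowerSeries.mk (hsymm R)

variable (R) in
/-- The generating function of the power sum symmetric functions, with `p_{k+1}` in degree `k`. -/
def psumSeries : PowerSeries (SymFunc R) := PowerSeries.mk fun k => psum R (k + 1)

theorem rescale_esymmSeries_mul_hsymmSeries :
    PowerSeries.rescale (-1) (esymmSeries R) * hsymmSeries R = 1 := by
  ext1 k
  simp only [PowerSeries.coeff_mul, PowerSeries.coeff_one, PowerSeries.coeff_rescale, esymmSeries,
    hsymmSeries, PowerSeries.coeff_mk, mul_assoc]
  split_ifs with hk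
  · simp [hk, esymm_zero, hsymm_zero]
  · exact sum_esymm_mul_hsymm hk

theorem derivative_esymmSeries :
    PowerSeries.derivative (SymFunc R) (esymmSeries R) =
      PowerSeries.rescale (-1) (psumSeries R) * esymmSeries R := by
  ext1 k
  simp only [PowerSeries.coeff_derivative, PowerSeries.coeff_mul, PowerSeries.coeff_rescale,
    psumSeries, esymmSeries, PowerSeries.coeff_mk]
  rw [← succ_mul_esymm, Nat.cast_succ, mul_comm]

theorem derivative_rescale_neg_one {A : Type*} [CommRing A] (F : PowerSeries A) :
    PowerSeries.derivative A (PowerSeries.rescale (-1) F) =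
      -PowerSeries.rescale (-1) (PowerSeries.derivative A F) := by
  ext1 k
  simp only [PowerSeries.coeff_derivative, PowerSeries.coeff_rescale, map_neg]
  ring

theorem rescale_neg_one_rescale_neg_one {A : Type*} [CommRing A] (F : PowerSeries A) :
    PowerSeries.rescale (-1) (PowerSeries.rescale (-1) F) = F := by
  rw [PowerSeries.rescale_rescale, neg_one_mul, neg_neg, PowerSeries.rescale_one, RingHom.id_apply]

theorem derivative_hsymmSeries :
    PowerSeries.derivative (SymFunc R) (hsymmSeries R) = psumSeries R * hsymmSeries R := by
  have hEH := rescale_esymmSeries_mul_hsymmSeries (R := R)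
  have hderivative := congrArg (PowerSeries.derivative (SymFunc R)) hEH
  rw [Derivation.leibniz, derivative_rescale_neg_one, derivative_esymmSeries, map_mul,
    rescale_neg_one_rescale_neg_one, Derivation.map_one_eq_zero, smul_eq_mul, smul_eq_mul]
    at hderivative
  linear_combination hsymmSeries R * hderivative +
    (psumSeries R * hsymmSeries R - PowerSeries.derivative _ (hsymmSeries R)) * hEH

theorem map_omegaInvolution_psumSeries :
    PowerSeries.map (omegaInvolution R : SymFunc R →+* SymFunc R) (psumSeries R) =
      PowerSeries.rescale (-1) (psumSeries R) := by
  set ω : SymFunc R →+* SymFunc R := (omegaInvolution R : SymFunc R →+* SymFunc R)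
  have hH : PowerSeries.map ω (hsymmSeries R) = esymmSeries R := by
    ext1 k
    rw [PowerSeries.coeff_map, hsymmSeries, esymmSeries, PowerSeries.coeff_mk,
      PowerSeries.coeff_mk]
    exact omegaInvolution_hsymm k
  have hH' : PowerSeries.map ω (PowerSeries.derivative _ (hsymmSeries R)) =
      PowerSeries.derivative _ (esymmSeries R) := by
    rw [← hH]
    ext1 k
    simp [PowerSeries.coeff_derivative]
  have hunit := congrArg (PowerSeries.map ω) (rescale_esymmSeries_mul_hsymmSeries (R := R))
  rw [map_mul, map_one, hH] at hunit
  rw [derivative_hsymmSeries, map_mul, hH, derivative_esymmSeries] at hH'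
  exact (IsUnit.of_mul_eq_one_right _ hunit).mul_right_cancel hH'

theorem omegaInvolution_psum {k : ℕ} (hk : k ≠ 0) :
    omegaInvolution R (psum R k) = (-1) ^ (k + 1) * psum R k := by
  obtain ⟨k, rfl⟩ := Nat.exists_eq_add_one_of_ne_zero hk
  have hcoeff := congrArg (PowerSeries.coeff k) (map_omegaInvolution_psumSeries (R := R))
  rw [PowerSeries.coeff_map, PowerSeries.coeff_rescale, psumSeries, PowerSeries.coeff_mk] at hcoeff
  refine hcoeff.trans ?_
  ring

theorem omegaInvolution_psumPart {n : ℕ} (μ : n.Partition) :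
    omegaInvolution R (psumPart R μ) =
      (-1) ^ (∑ i, ((sortedComposition μ).blocksFun i + 1)) * psumPart R μ := by
  rw [psumPart_eq_prod, map_prod, ← Finset.prod_pow_eq_pow_sum, ← Finset.prod_mul_distrib]
  exact Finset.prod_congr rfl fun i _ =>
    omegaInvolution_psum (Nat.pos_iff_ne_zero.1 ((sortedComposition μ).one_le_blocksFun i))

end Newton

section Span

variable {R : Type*} [CommRing R]

theorem isHomogeneous_psum (k : ℕ) : IsHomogeneous (psum R k : MvPowerSeries ℕ R) k := by
  intro m hm
  obtain ⟨i, rfl⟩ : ∃ i, m = single i k := by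
    by_contra h
    exact hm (if_neg h)
  rw [weight_single, Pi.one_apply, nsmul_one, Nat.cast_id]

theorem isHomogeneous_prod_psum (t : Multiset ℕ) :
    IsHomogeneous ((t.map (psum R)).prod : MvPowerSeries ℕ R) t.sum := by
  induction t using Multiset.induction_on with
  | empty =>
    classical
    intro m hm
    rw [Multiset.map_zero, Multiset.prod_zero, OneMemClass.coe_one, coeff_one] at hm
    rw [of_not_not fun h => hm (if_neg h), map_zero, Multiset.sum_zero]
  | cons k t ih =>
    rw [Multiset.map_cons, Multiset.prod_cons, Multiset.sum_cons, Subalgebra.coe_mul]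
    exact IsHomogeneous.mul (isHomogeneous_psum k) ih

theorem isHomogeneous_chromaticQSym {V : Type*} [Fintype V] (D : Digraph V) :
    IsHomogeneous (chromaticQSym D) (Fintype.card V) := by
  classical
  intro m hm
  obtain ⟨κ, hκ, -⟩ := Finset.exists_ne_zero_of_sum_ne_zero hm
  rw [← (Finset.mem_filter.1 hκ).2.2, colorExponent, map_sum]
  simp [weight_single]

theorem esymm_mem_adjoin_psum [Algebra ℚ R] (k : ℕ) :
    esymm R k ∈ Algebra.adjoin R (Set.range fun k => psum R (k + 1)) := by
  induction k using Nat.strong_induction_on with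
  | _ k ih =>
    rcases k with _ | k
    · rw [esymm_zero]
      exact one_mem _
    have hmem : ((k + 1 : ℕ) : SymFunc R) * esymm R (k + 1) ∈
        Algebra.adjoin R (Set.range fun k => psum R (k + 1)) := by
      rw [succ_mul_esymm]
      refine sum_mem fun p hp => mul_mem (mul_mem (pow_mem (neg_mem (one_mem _)) _)
        (Algebra.subset_adjoin ⟨p.1, rfl⟩)) (ih _ ?_)
      exact Nat.lt_succ_of_le (Finset.HasAntidiagonal.antidiagonal.snd_le hp)
    have hinv : algebraMap ℚ R ((k + 1 : ℕ) : ℚ)⁻¹ * ((k + 1 : ℕ) : R) = 1 := by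
      rw [← map_natCast (algebraMap ℚ R), ← map_mul,
        inv_mul_cancel₀ (Nat.cast_ne_zero.2 k.succ_ne_zero), map_one]
    have hsmul := Subalgebra.smul_mem _ hmem (algebraMap ℚ R ((k + 1 : ℕ) : ℚ)⁻¹)
    rwa [← nsmul_eq_mul, ← Nat.cast_smul_eq_nsmul R, smul_smul, hinv, one_smul] at hsmul

theorem adjoin_psum_eq_top [Algebra ℚ R] :
    Algebra.adjoin R (Set.range fun k => psum R (k + 1)) = ⊤ := by
  rw [eq_top_iff, ← AlgHom.range_eq_top (ofEsymm R) |>.2 ofEsymm_surjective, ofEsymm,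
    ← Algebra.adjoin_range_eq_range_aeval]
  refine Algebra.adjoin_le ?_
  rintro _ ⟨k, rfl⟩
  exact esymm_mem_adjoin_psum _

theorem exists_prod_psum_of_mem_closure {f : SymFunc R}
    (hf : f ∈ Submonoid.closure (Set.range fun k => psum R (k + 1))) :
    ∃ t : Multiset ℕ, (∀ k ∈ t, 0 < k) ∧ f = (t.map (psum R)).prod := by
  induction hf using Submonoid.closure_induction with
  | mem f hf =>
    obtain ⟨k, rfl⟩ := hf
    exact ⟨{k + 1}, by simp⟩
  | one => exact ⟨0, by simp⟩
  | mul f g _ _ hf hg =>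
    obtain ⟨s, hs, rfl⟩ := hf
    obtain ⟨t, ht, rfl⟩ := hg
    exact ⟨s + t, fun k hk => (Multiset.mem_add.1 hk).elim (hs k) (ht k), by simp⟩

theorem homogeneousComponent_prod_psum_mem_span {t : Multiset ℕ} (ht : ∀ k ∈ t, 0 < k) (n : ℕ) :
    homogeneousComponent n ((t.map (psum R)).prod : MvPowerSeries ℕ R) ∈
      Submodule.span R (Set.range fun μ : n.Partition => (psumPart R μ : MvPowerSeries ℕ R)) := by
  have hhom := @isHomogeneous_prod_psum R _ t
  by_cases hn : t.sum = n
  · subst hn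
    rw [← isHomogeneous_iff_eq_homogeneousComponent.1 hhom]
    exact Submodule.subset_span ⟨⟨t, ht _, rfl⟩, rfl⟩
  · have hzero : homogeneousComponent n ((t.map (psum R)).prod : MvPowerSeries ℕ R) = 0 := by
      ext m
      rw [coeff_homogeneousComponent, map_zero]
      split_ifs with hm
      · exact hhom.coeff_eq_zero (hm.trans_ne (Ne.symm hn))
      · rfl
    rw [hzero]
    exact zero_mem _

theorem homogeneousComponent_mem_span_psumPart [Algebra ℚ R] (f : SymFunc R) (n : ℕ) :
    homogeneousComponent n (f : MvPowerSeries ℕ R) ∈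
      Submodule.span R (Set.range fun μ : n.Partition => (psumPart R μ : MvPowerSeries ℕ R)) := by
  have hf : f ∈ Submodule.span R
      (Submonoid.closure (Set.range fun k => psum R (k + 1)) : Set (SymFunc R)) := by
    rw [← Algebra.adjoin_eq_span, adjoin_psum_eq_top]
    trivial
  refine (Submodule.map_span_le (homogeneousComponent n ∘ₗ (SymFunc R).val.toLinearMap) _ _).2
    (fun g hg => ?_) (Submodule.mem_map_of_mem hf)
  obtain ⟨t, ht, rfl⟩ := exists_prod_psum_of_mem_closure hg
  exact homogeneousComponent_prod_psum_mem_span ht n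

theorem exists_eq_sum_psumPart [Algebra ℚ R] {n : ℕ} {f : SymFunc R}
    (hf : IsHomogeneous (f : MvPowerSeries ℕ R) n) :
    ∃ a : n.Partition → R, f = ∑ μ, a μ • psumPart R μ := by
  have hspan := homogeneousComponent_mem_span_psumPart f n
  rw [← isHomogeneous_iff_eq_homogeneousComponent.1 hf,
    Submodule.mem_span_range_iff_exists_fun] at hspan
  obtain ⟨a, ha⟩ := hspan
  exact ⟨a, Subtype.ext (ha.symm.trans (by simp))⟩

end Span

section Expansion

variable {n : ℕ}

theorem exists_strictAnti_embedding (α : Type*) [LinearOrder α] [Finite α] :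
    ∃ e : α ↪ ℕ, StrictAnti e := by
  cases nonempty_fintype α
  let rank : α ≃o Fin (Fintype.card α) := (Fintype.orderIsoFinOfCardEq α rfl).symm
  have hanti : StrictAnti fun a => ((rank a).rev : ℕ) :=
    fun a b hab => Fin.rev_lt_rev.2 (rank.strictMono hab)
  exact ⟨⟨_, hanti.injective⟩, hanti⟩

theorem zPart_pos (μ : n.Partition) : 0 < zPart μ :=
  Finset.prod_pos fun _ hi => Nat.mul_pos (Nat.factorial_pos _)
    (pow_pos (μ.parts_pos (Multiset.mem_toFinset.1 hi)) _)

theorem mul_zPart_of_chromaticQSym_eq {D : Digraph (Fin n)} {a : n.Partition → Polynomial ℚ}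
    (ha : chromaticQSym D =
      ∑ ρ, a ρ • (psumPart (Polynomial ℚ) ρ : MvPowerSeries ℕ (Polynomial ℚ)))
    (μ : n.Partition) :
    a μ * (zPart μ : Polynomial ℚ) = (-1) ^ (∑ i, ((sortedComposition μ).blocksFun i + 1)) *
      ∑ σ ∈ NSet μ D.toSimpleGraphInclusive, Polynomial.X ^ digraphInv D σ := by
  obtain ⟨e, he⟩ :=
    exists_strictAnti_embedding (Fin (sortedComposition μ).length ×ₗ Fin (n + 1))
  have hX := rowFunctional_chromaticQSym D (N := n) ((Fintype.card_fin n).trans_le n.le_succ) he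
    (sortedComposition μ).blocksFun
  rw [sum_NSet, ← hX, Fintype.card_fin, ha, map_sum]
  simp only [map_smul, rowFunctional_psumPart, smul_eq_mul, mul_ite, mul_zero]
  rw [Finset.sum_ite_eq' Finset.univ μ, if_pos (Finset.mem_univ _)]

theorem chromaticQSym_eq_sum_psumPart {D : Digraph (Fin n)}
    (hX : chromaticQSym D ∈ SymFunc (Polynomial ℚ)) :
    (⟨chromaticQSym D, hX⟩ : SymFunc (Polynomial ℚ)) =
      ∑ μ : n.Partition, ((-1) ^ (∑ i, ((sortedComposition μ).blocksFun i + 1)) *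
        (Polynomial.C ((zPart μ : ℚ)⁻¹) *
          ∑ σ ∈ NSet μ D.toSimpleGraphInclusive, Polynomial.X ^ digraphInv D σ)) •
            psumPart (Polynomial ℚ) μ := by
  have hhom := @isHomogeneous_chromaticQSym _ _ D
  rw [Fintype.card_fin] at hhom
  obtain ⟨a, ha⟩ := exists_eq_sum_psumPart (f := ⟨chromaticQSym D, hX⟩) hhom
  rw [ha]
  refine Finset.sum_congr rfl fun μ _ => congrArg (· • psumPart (Polynomial ℚ) μ) ?_
  have hcoeff := mul_zPart_of_chromaticQSym_eq
    (by simpa using congrArg (SymFunc (Polynomial ℚ)).val ha) μ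
  have hz : (zPart μ : Polynomial ℚ) * Polynomial.C ((zPart μ : ℚ)⁻¹) = 1 := by
    rw [← map_natCast Polynomial.C, ← map_mul, mul_inv_cancel₀, map_one]
    exact_mod_cast (zPart_pos μ).ne'
  rw [mul_left_comm, ← hcoeff, mul_comm, mul_assoc, hz, mul_one]

theorem omegaInvolution_chromaticQSym {D : Digraph (Fin n)}
    (hX : chromaticQSym D ∈ SymFunc (Polynomial ℚ)) :
    omegaInvolution (Polynomial ℚ) ⟨chromaticQSym D, hX⟩ =
      ∑ μ : n.Partition, (Polynomial.C ((zPart μ : ℚ)⁻¹) *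
        ∑ σ ∈ NSet μ D.toSimpleGraphInclusive, Polynomial.X ^ digraphInv D σ) •
          psumPart (Polynomial ℚ) μ := by
  rw [chromaticQSym_eq_sum_psumPart hX, map_sum]
  refine Finset.sum_congr rfl fun μ _ => ?_
  set s := ∑ i, ((sortedComposition μ).blocksFun i + 1)
  have hsign : (-1 : SymFunc (Polynomial ℚ)) ^ s = algebraMap (Polynomial ℚ) _ ((-1) ^ s) := by
    rw [map_pow, map_neg, map_one]
  rw [map_smul, omegaInvolution_psumPart, hsign, ← Algebra.smul_def, smul_smul, mul_right_comm,
    neg_one_pow_mul_self, one_mul]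

theorem coeff_C_mul_sum_X_pow_nonneg {ι K : Type*} [Semiring K] [PartialOrder K]
    [IsOrderedRing K] {c : K} (hc : 0 ≤ c) (s : Finset ι) (f : ι → ℕ) (j : ℕ) :
    0 ≤ (Polynomial.C c * ∑ i ∈ s, Polynomial.X ^ f i).coeff j := by
  rw [Polynomial.coeff_C_mul, Polynomial.finsetSum_coeff]
  refine mul_nonneg hc (Finset.sum_nonneg fun i _ => ?_)
  rw [Polynomial.coeff_X_pow]
  split_ifs <;> simp

end Expansion

end ChromQSym

end

theorem theorem4p2 {n : ℕ} (D : Digraph (Fin n)) (hD : ∀ v, ¬ D.Adj v v)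
    (hX : ChromQSym.chromaticQSym D ∈ ChromQSym.SymFunc (Polynomial ℚ)) :
    ChromQSym.IsPPositive n
        (ChromQSym.omegaInvolution (Polynomial ℚ) ⟨ChromQSym.chromaticQSym D, hX⟩) ∧
      ChromQSym.omegaInvolution (Polynomial ℚ) ⟨ChromQSym.chromaticQSym D, hX⟩ =
        ∑ μ : n.Partition,
          (Polynomial.C ((ChromQSym.zPart μ : ℚ)⁻¹) *
            ∑ σ ∈ ChromQSym.NSet μ D.toSimpleGraphInclusive,
              Polynomial.X ^ ChromQSym.digraphInv D σ) •
            ChromQSym.psumPart (Polynomial ℚ) μ := by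
  have hexpansion := ChromQSym.omegaInvolution_chromaticQSym hX
  exact ⟨⟨_, fun μ => ChromQSym.coeff_C_mul_sum_X_pow_nonneg (by positivity) _ _, hexpansion⟩,
    hexpansion⟩
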